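/- Let $\overline{p}_o(n)$ be the number of overpartitions of $n$ into odd parts (an overpartition of $n$ is a partition of $n$ in which the first occurrence of each part size may be overlined), let $ped(n)$ be the number of partitions of $n$ in which no even part is repeated, and let $R(n,Q)$ be the number of pairs $(x,y)\in\mathbb{Z}^2$ with $Q(x,y)=n$. Put $f(n)=-1$ if $n\equiv 1,6,9,10 \pmod{12}$ and $f(n)=1$ otherwise. Then for all integers $n\ge 0$, $$\overline{p}_o(3n)\equiv f(n)\,R(n,x^2+6y^2)\pmod 3,$$ $$ped(3n+1)\equiv(-1)^{n+1}R(8n+3,2x^2+3y^2)\pmod 3.$$ Moreover, for every $n\ge 1$, write $$n=2^a3^b\prod_{i=1}^r p_i^{v_i}\prod_{j=1}^s q_j^{w_j}$$ with $p_i$, $q_j$ distinct primes, $v_i,w_j\ge1$, $p_i\equiv 1,5,7,11\pmod{24}$ and $q_j\equiv 13,17,19,23\pmod{24}$, and let $t$ be the number of prime factors of $n$, counted with multiplicity, that are congruent to $5$ or $11$ modulo $24$. Then $$\overline{p}_o(3n)\equiv f(n)\left(1+(-1)^{a+b+t}\right)\prod_{i=1}^r(1+v_i)\prod_{j=1}^s\frac{1+(-1)^{w_j}}{2}\pmod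 3.$$ Finally, for all $n\ge 0$, $$(-1)^n\,ped(3n+1)\equiv\overline{p}_o(48n+18)\pmod 3.$$ -/

import Mathlib

open Finset

/-- The overpartitions of `n`: a partition `π` of `n` together with the set `S` of those part
sizes whose first occurrence is overlined. -/
def overpartitions (n : ℕ) : Finset (Σ _ : n.Partition, Finset ℕ) :=
  (univ : Finset n.Partition).sigma fun π => π.parts.toFinset.powerset

/-- The number of overpartitions of `n` into odd parts. -/
def poBar (n : ℕ) : ℕ :=
  #{x ∈ overpartitions n | ∀ i ∈ x.1.parts, Odd i}

/-- The number of partitions of `n` without repeated even parts. -/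
def ped (n : ℕ) : ℕ :=
  #{π : n.Partition | ∀ i ∈ π.parts, Even i → π.parts.count i = 1}

/-- The number of representations of `n` by the binary form `Q`, i.e. of pairs of integers `(x, y)`
with `Q x y = n` (a finite number when `Q` is positive definite, as all forms used here are). -/
noncomputable def numReps (n : ℕ) (Q : ℤ → ℤ → ℤ) : ℕ :=
  {v : ℤ × ℤ | Q v.1 v.2 = n}.ncard

/-- The sign `f(n)`. -/
def signF (n : ℕ) : ℤ :=
  if n % 12 = 1 ∨ n % 12 = 6 ∨ n % 12 = 9 ∨ n % 12 = 10 then -1 else 1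

/-- The prime divisors of `n` congruent to 1, 5, 7 or 11 modulo 24. -/
def pPrimes (n : ℕ) : Finset ℕ :=
  {p ∈ n.primeFactors | p % 24 = 1 ∨ p % 24 = 5 ∨ p % 24 = 7 ∨ p % 24 = 11}

/-- The prime divisors of `n` congruent to 13, 17, 19 or 23 modulo 24. -/
def qPrimes (n : ℕ) : Finset ℕ :=
  {q ∈ n.primeFactors | q % 24 = 13 ∨ q % 24 = 17 ∨ q % 24 = 19 ∨ q % 24 = 23}

/-- The number of prime factors of `n`, counted with multiplicity, congruent to 5 or 11
modulo 24. -/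
def tCount (n : ℕ) : ℕ :=
  ∑ p ∈ n.primeFactors with p % 24 = 5 ∨ p % 24 = 11, n.factorization p

/-! Everything takes place in power series over `ZMod 3`. Gauss's product formulas turn the two
generating functions into theta quotients: with φ(q) = ∑ q^(x²) over all integers and ψ(q) = ∑
q^(k(k+1)/2) over k ≥ 0, overpartitions into odd parts give φ(-q²)/φ(-q), and `ped` gives
ψ(-q)/φ(-q).

By Frobenius φ(-q)³ = φ(-q³), a series in q³, so multiplying by it commutes with extracting the
exponents in one class modulo 3 (`progression_mul_pow_three`). It remains to extract from
φ(-q²)φ(-q)², a signed count of solutions of 2x² + y² + z² = 3n. Modulo 3 this form has exactly four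
isotropic lines, permuted by y ↦ -y and y ↔ z. A nonzero isotropic vector lies on one of them and
the zero vector on all four, and 4 = 1 in `ZMod 3`. Hence the count equals the count over a single
line, where the form becomes 3(s² + 2t² + 3w²) (`sum_ternarySolutions`). For `ped` the same lemma
applies after q ↦ -q and completing the square. Classical theta identities then give φ(-q⁶)φ(-q)
and, up to the factor 2, ψ(q³)φ(q), whose coefficients are the stated representation numbers up to
sign.

The explicit formula comes from the two reduced forms of discriminant -24, x² + 6y² and 2x² + 3y².
Their class group is `ZMod 2`. Composition with a prime p gives a Hecke-type recursion relating the
representation numbers of pn, n and n/p (`classReps_two_mul`, `classReps_three_mul`,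
`classReps_split`, `classReps_inert`), and iterating over the factorization of n yields
`classReps_eq`. The last congruence follows because 16n + 6 = x² + 6y² forces x to be even. -/

/-! ### Generalized theta series -/

/-- All fibres of the exponent function are finite. -/
def FiniteFibers {ι : Type*} (f : ι → ℤ) : Prop := ∀ n : ℤ, {i | f i = n}.Finite

/-- The series `∑ w i * X ^ f i`. -/
noncomputable def thetaSeries {ι R : Type*} [Semiring R] (f : ι → ℤ) (w : ι → R) :
    PowerSeries R :=
  PowerSeries.mk fun n => ∑ᶠ i ∈ {i | f i = (n : ℤ)}, w i

section Theta

variable {ι κ R : Type*} [CommSemiring R]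

lemma coeff_thetaSeries (f : ι → ℤ) (w : ι → R) (n : ℕ) :
    (thetaSeries f w).coeff n = ∑ᶠ i ∈ {i | f i = (n : ℤ)}, w i :=
  PowerSeries.coeff_mk _ _

lemma FiniteFibers.add {f : ι → ℤ} {g : κ → ℤ} (hf : FiniteFibers f) (hg : FiniteFibers g)
    (hf0 : ∀ i, 0 ≤ f i) (hg0 : ∀ i, 0 ≤ g i) :
    FiniteFibers fun p : ι × κ => f p.1 + g p.2 := by
  intro n
  refine Set.Finite.subset (Set.Finite.biUnion (Set.finite_Icc (0 : ℤ) n)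
    fun a _ => (hf a).prod (hg (n - a))) ?_
  rintro ⟨i, j⟩ h
  have := hf0 i
  have := hg0 j
  simp only [Set.mem_ofPred_eq] at h
  simp only [Set.mem_iUnion, Set.mem_prod, Set.mem_ofPred_eq, Set.mem_Icc, exists_prop]
  exact ⟨f i, by omega, rfl, by omega⟩

/-- Finite fibres matter because `finsum` takes the value 0 on infinite support; nonnegativity
ensures that no pair with a negative exponent contributes to the sum. -/
lemma thetaSeries_mul {f : ι → ℤ} {g : κ → ℤ} (hf : FiniteFibers f) (hg : FiniteFibers g)
    (hf0 : ∀ i, 0 ≤ f i) (hg0 : ∀ i, 0 ≤ g i) (w : ι → R) (v : κ → R) :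
    thetaSeries f w * thetaSeries g v =
      thetaSeries (fun p : ι × κ => f p.1 + g p.2) fun p => w p.1 * v p.2 := by
  ext n
  rw [PowerSeries.coeff_mul, coeff_thetaSeries,
    finsum_mem_eq_finite_toFinset_sum _ (hf.add hg hf0 hg0 n)]
  rw [← Finset.sum_fiberwise_of_maps_to (t := antidiagonal n)
    (g := fun p : ι × κ => ((f p.1).toNat, (g p.2).toNat))]
  · refine Finset.sum_congr rfl fun ab hab => ?_
    rw [HasAntidiagonal.mem_antidiagonal] at hab
    rw [coeff_thetaSeries, coeff_thetaSeries, finsum_mem_eq_finite_toFinset_sum _ (hf _),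
      finsum_mem_eq_finite_toFinset_sum _ (hg _), Finset.sum_mul_sum, ← Finset.sum_product']
    refine Finset.sum_congr ?_ fun _ _ => rfl
    ext ⟨i, j⟩
    have := hf0 i
    have := hg0 j
    simp only [mem_product, Set.Finite.mem_toFinset, Set.mem_ofPred_eq, mem_filter, Prod.ext_iff]
    omega
  · rintro ⟨i, j⟩ h
    have := hf0 i
    have := hg0 j
    simp only [Set.Finite.mem_toFinset, Set.mem_ofPred_eq] at h
    rw [HasAntidiagonal.mem_antidiagonal]
    simp only
    omega

lemma expand_thetaSeries {R : Type*} [CommRing R] (m : ℕ) (hm : m ≠ 0) (f : ι → ℤ) (w : ι → R) :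
    PowerSeries.expand m hm (thetaSeries f w) = thetaSeries (fun i => m * f i) w := by
  ext n
  rw [PowerSeries.coeff_expand]
  split_ifs with h
  · obtain ⟨k, rfl⟩ := h
    rw [Nat.mul_div_cancel_left _ (Nat.pos_of_ne_zero hm), coeff_thetaSeries, coeff_thetaSeries]
    congr! 4 with i
    push_cast
    simp [hm]
  · rw [coeff_thetaSeries]
    symm
    apply finsum_mem_eq_zero_of_forall_eq_zero
    intro i hi
    exact absurd (Int.natCast_dvd_natCast.1 ⟨f i, hi.symm⟩) h

end Theta

/-! ### The basic series over the field with three elements -/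

/-- The character `(-1) ^ x`. -/
def paritySign (x : ℤ) : ZMod 3 := if Even x then 1 else -1

lemma paritySign_add (x y : ℤ) : paritySign (x + y) = paritySign x * paritySign y := by
  unfold paritySign
  by_cases hx : Even x <;> by_cases hy : Even y <;> simp [Int.even_add, hx, hy]

lemma paritySign_neg (x : ℤ) : paritySign (-x) = paritySign x := by
  simp [paritySign]

lemma paritySign_two_mul (x : ℤ) : paritySign (2 * x) = 1 := by
  simp [paritySign]

lemma paritySign_mul_self (x : ℤ) : paritySign x * paritySign x = 1 := by
  rw [← paritySign_add, ← two_mul, paritySign_two_mul]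

lemma paritySign_sub (x y : ℤ) : paritySign (x - y) = paritySign x * paritySign y := by
  rw [sub_eq_add_neg, paritySign_add, paritySign_neg]

/-- The triangular numbers, indexed by all integers. -/
def triangular (k : ℤ) : ℤ := k * (k + 1) / 2

lemma two_mul_triangular (k : ℤ) : 2 * triangular k = k * (k + 1) :=
  Int.mul_ediv_cancel' (Int.even_mul_succ_self k).two_dvd

lemma triangular_nonneg (k : ℤ) : 0 ≤ triangular k := by
  have := two_mul_triangular k
  rcases le_or_gt 0 k with h | h <;> nlinarith

lemma finiteFibers_mul_sq {c : ℤ} (hc : 0 < c) : FiniteFibers fun x : ℤ => c * x ^ 2 := by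
  intro n
  refine (Set.finite_Icc (-n) n).subset fun x hx => ?_
  simp only [Set.mem_ofPred_eq] at hx
  rw [Set.mem_Icc, ← abs_le]
  have h1 : |x| ≤ x ^ 2 := by
    rw [← sq_abs]
    rcases (abs_nonneg x).eq_or_lt' with h | h
    · simp [h]
    · nlinarith
  nlinarith [sq_nonneg x]

lemma finiteFibers_mul_triangular {c : ℤ} (hc : 0 < c) :
    FiniteFibers fun k : ℤ => c * triangular k := by
  intro n
  refine (Set.finite_Icc (-n - 1) n).subset fun k hk => ?_
  simp only [Set.mem_ofPred_eq] at hk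
  have h := two_mul_triangular k
  have h0 := triangular_nonneg k
  have h1 : triangular k ≤ n := by nlinarith
  rw [Set.mem_Icc]
  constructor
  · by_contra hh
    nlinarith
  · by_contra hh
    nlinarith

/-- `φ(q ^ c)` modulo 3. -/
noncomputable def phiPlus (c : ℤ) : PowerSeries (ZMod 3) := thetaSeries (fun x => c * x ^ 2) 1

/-- `φ(-q ^ c)` modulo 3. -/
noncomputable def phiMinus (c : ℤ) : PowerSeries (ZMod 3) :=
  thetaSeries (fun x => c * x ^ 2) paritySign

/-- `2 * ψ(q ^ c)` modulo 3. -/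
noncomputable def psiSum (c : ℤ) : PowerSeries (ZMod 3) :=
  thetaSeries (fun k => c * triangular k) 1

/-- Cubing is a ring homomorphism in characteristic 3 and fixes the coefficients in `ZMod 3`. -/
lemma expand_three_eq_pow (f : PowerSeries (ZMod 3)) :
    PowerSeries.expand 3 three_ne_zero f = f ^ 3 := by
  have : Fact (Nat.Prime 3) := ⟨Nat.prime_three⟩
  have h := MvPowerSeries.map_frobenius_expand (σ := Unit) (R := ZMod 3) 3 three_ne_zero (f := f)
  rw [ZMod.frobenius_zmod] at h
  rw [MvPowerSeries.map_id] at h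
  exact h

lemma phiPlus_pow_three (c : ℤ) : phiPlus c ^ 3 = phiPlus (3 * c) := by
  rw [← expand_three_eq_pow, phiPlus, expand_thetaSeries]
  simp [phiPlus, mul_assoc]

lemma phiMinus_pow_three (c : ℤ) : phiMinus c ^ 3 = phiMinus (3 * c) := by
  rw [← expand_three_eq_pow, phiMinus, expand_thetaSeries]
  simp [phiMinus, mul_assoc]

lemma psiSum_pow_three (c : ℤ) : psiSum c ^ 3 = psiSum (3 * c) := by
  rw [← expand_three_eq_pow, psiSum, expand_thetaSeries]
  simp [psiSum, mul_assoc]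

lemma finsum_mem_eq_sum_parts {α M : Type*} [AddCommMonoid M] {s : Set α} (hs : s.Finite)
    (p : α → Prop) (f : α → M) :
    ∑ᶠ i ∈ s, f i = ∑ᶠ i ∈ s ∩ {i | p i}, f i + ∑ᶠ i ∈ s ∩ {i | ¬ p i}, f i := by
  exact (finsum_mem_inter_add_sdiff {i | p i} hs).symm

/-- In ∑ (-1)^y q^(x² + y²) the pairs of opposite parity cancel under x ↔ y. Those of equal parity
are (a + b, a - b), with exponent 2a² + 2b² and sign (-1)^(a + b). -/
lemma phiPlus_mul_phiMinus : phiPlus 1 * phiMinus 1 = phiMinus 2 ^ 2 := by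
  have h1 := finiteFibers_mul_sq one_pos
  have h2 := finiteFibers_mul_sq two_pos
  have n1 : ∀ x : ℤ, 0 ≤ 1 * x ^ 2 := fun x => by positivity
  have n2 : ∀ x : ℤ, 0 ≤ 2 * x ^ 2 := fun x => by positivity
  rw [sq, phiPlus, phiMinus, thetaSeries_mul h1 h1 n1 n1, phiMinus,
    thetaSeries_mul h2 h2 n2 n2]
  ext n
  rw [coeff_thetaSeries, coeff_thetaSeries,
    finsum_mem_eq_sum_parts (h1.add h1 n1 n1 n) fun p => Even (p.1 + p.2)]
  have hodd : ∑ᶠ p ∈ {p : ℤ × ℤ | 1 * p.1 ^ 2 + 1 * p.2 ^ 2 = (n : ℤ)} ∩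
      {p | ¬ Even (p.1 + p.2)}, (1 : ℤ → ZMod 3) p.1 * paritySign p.2 = 0 := by
    set S := ∑ᶠ p ∈ {p : ℤ × ℤ | 1 * p.1 ^ 2 + 1 * p.2 ^ 2 = (n : ℤ)} ∩
      {p | ¬ Even (p.1 + p.2)}, (1 : ℤ → ZMod 3) p.1 * paritySign p.2 with hS
    have : S = -S := by
      conv_rhs => rw [hS]
      rw [← finsum_mem_neg_distrib _ ((h1.add h1 n1 n1 n).inter_of_left _)]
      refine finsum_mem_eq_of_bijOn Prod.swap ⟨?_, Prod.swap_injective.injOn, ?_⟩ ?_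
      · rintro ⟨x, y⟩ ⟨h, h'⟩
        simp only [Set.mem_ofPred_eq, Set.mem_inter_iff, Prod.swap] at h h' ⊢
        exact ⟨by linarith, by rwa [add_comm]⟩
      · rintro ⟨x, y⟩ ⟨h, h'⟩
        refine ⟨(y, x), ?_, rfl⟩
        simp only [Set.mem_ofPred_eq, Set.mem_inter_iff] at h h' ⊢
        exact ⟨by linarith, by rwa [add_comm]⟩
      · rintro ⟨x, y⟩ ⟨h, h'⟩
        simp only [Set.mem_ofPred_eq, Int.even_add, Pi.one_apply, one_mul, Prod.swap,
          paritySign] at h' ⊢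
        by_cases hx : Even x <;> by_cases hy : Even y <;>
          simp only [hx, hy, if_true, if_false, neg_neg] <;> tauto
    -- `S = -S` forces `S = 0` because 2 is invertible modulo 3.
    generalize S = z at this
    revert z
    decide
  rw [hodd, add_zero]
  symm
  refine finsum_mem_eq_of_bijOn (fun p => (p.1 + p.2, p.1 - p.2)) ⟨?_, ?_, ?_⟩ ?_
  · rintro ⟨x, y⟩ h
    simp only [Set.mem_ofPred_eq, Set.mem_inter_iff] at h ⊢
    exact ⟨by linarith, ⟨x, by ring⟩⟩
  · rintro ⟨x, y⟩ _ ⟨x', y'⟩ _ h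
    simp only [Prod.ext_iff] at h ⊢
    omega
  · rintro ⟨x, y⟩ ⟨h, ⟨c, hc⟩⟩
    simp only [Set.mem_ofPred_eq] at h hc
    refine ⟨(c, x - c), ?_, ?_⟩
    · obtain rfl : y = c + c - x := by omega
      simp only [Set.mem_ofPred_eq]
      linarith
    · simp only [Prod.ext_iff]
      omega
  · rintro ⟨x, y⟩ _
    simp [paritySign_sub]

/-- This is ψ(q)² = ψ(q²)φ(q), with ψ doubled by indexing over all integers. The reflection k ↦ -1 -
k preserves triangular numbers and flips parity, so the pairs with odd sum contribute as much as
those with even sum; the latter are (l + y, l - y). -/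
lemma psiSum_sq : psiSum 1 ^ 2 = 2 * (psiSum 2 * phiPlus 1) := by
  have h1 := finiteFibers_mul_triangular one_pos
  have h2 := finiteFibers_mul_triangular two_pos
  have h3 := finiteFibers_mul_sq one_pos
  have n1 : ∀ k : ℤ, 0 ≤ 1 * triangular k := fun k => by simpa using triangular_nonneg k
  have n2 : ∀ k : ℤ, 0 ≤ 2 * triangular k := fun k => by simpa using triangular_nonneg k
  have n3 : ∀ x : ℤ, 0 ≤ 1 * x ^ 2 := fun x => by positivity
  rw [sq, psiSum, phiPlus, thetaSeries_mul h1 h1 n1 n1, psiSum,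
    thetaSeries_mul h2 h3 n2 n3, two_mul]
  ext n
  rw [map_add, coeff_thetaSeries, coeff_thetaSeries,
    finsum_mem_eq_sum_parts (h1.add h1 n1 n1 n) fun p => Even (p.1 + p.2)]
  have hreflect : ∀ k : ℤ, triangular (-1 - k) = triangular k := fun k => by
    rw [triangular, triangular]; ring_nf
  have hodd : ∑ᶠ p ∈ {p : ℤ × ℤ | 1 * triangular p.1 + 1 * triangular p.2 = (n : ℤ)} ∩
        {p | ¬ Even (p.1 + p.2)}, (1 : ℤ → ZMod 3) p.1 * (1 : ℤ → ZMod 3) p.2 =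
      ∑ᶠ p ∈ {p : ℤ × ℤ | 1 * triangular p.1 + 1 * triangular p.2 = (n : ℤ)} ∩
        {p | Even (p.1 + p.2)}, (1 : ℤ → ZMod 3) p.1 * (1 : ℤ → ZMod 3) p.2 := by
    refine finsum_mem_eq_of_bijOn (fun p => (-1 - p.1, p.2)) ⟨?_, ?_, ?_⟩ fun _ _ => rfl
    · rintro ⟨x, y⟩ ⟨h, h'⟩
      simp only [Set.mem_ofPred_eq, Set.mem_inter_iff, hreflect] at h h' ⊢
      exact ⟨h, by grind⟩
    · rintro ⟨x, y⟩ _ ⟨x', y'⟩ _ h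
      simp only [Prod.ext_iff] at h ⊢
      omega
    · rintro ⟨x, y⟩ ⟨h, h'⟩
      refine ⟨(-1 - x, y), ?_, by simp⟩
      simp only [Set.mem_ofPred_eq, Set.mem_inter_iff, hreflect] at h h' ⊢
      exact ⟨h, by grind⟩
  have key : ∀ l y : ℤ, triangular (l + y) + triangular (l - y) = 2 * triangular l + y ^ 2 := by
    intro l y
    have e1 := two_mul_triangular (l + y)
    have e2 := two_mul_triangular (l - y)
    have e3 := two_mul_triangular l
    linarith
  rw [hodd]
  suffices h : ∑ᶠ p ∈ {p : ℤ × ℤ | 2 * triangular p.1 + 1 * p.2 ^ 2 = (n : ℤ)},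
        (1 : ℤ → ZMod 3) p.1 * (1 : ℤ → ZMod 3) p.2 =
      ∑ᶠ p ∈ {p : ℤ × ℤ | 1 * triangular p.1 + 1 * triangular p.2 = (n : ℤ)} ∩
        {p | Even (p.1 + p.2)}, (1 : ℤ → ZMod 3) p.1 * (1 : ℤ → ZMod 3) p.2 by rw [h]
  refine finsum_mem_eq_of_bijOn (fun p => (p.1 + p.2, p.1 - p.2)) ⟨?_, ?_, ?_⟩ fun _ _ => rfl
  · rintro ⟨x, y⟩ h
    simp only [Set.mem_ofPred_eq, Set.mem_inter_iff] at h ⊢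
    have := key x y
    exact ⟨by linarith, ⟨x, by ring⟩⟩
  · rintro ⟨x, y⟩ _ ⟨x', y'⟩ _ h
    simp only [Prod.ext_iff] at h ⊢
    omega
  · rintro ⟨x, y⟩ ⟨h, ⟨c, hc⟩⟩
    simp only [Set.mem_ofPred_eq] at h hc
    refine ⟨(c, x - c), ?_, ?_⟩
    · obtain rfl : y = c + c - x := by omega
      have := key c (x - c)
      rw [show c + (x - c) = x by ring, show c - (x - c) = c + c - x by ring] at this
      simp only [Set.mem_ofPred_eq]
      linarith
    · simp only [Prod.ext_iff]
      omega

/-! ### The four isotropic lines modulo 3 of `2x² + y² + z²` -/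

/-- The integral solutions of `a x² + b y² + c z² = n`. -/
def ternarySolutions (a b c n : ℤ) : Set (ℤ × ℤ × ℤ) :=
  {v | a * v.1 ^ 2 + b * v.2.1 ^ 2 + c * v.2.2 ^ 2 = n}

lemma finite_ternarySolutions {a b c : ℤ} (ha : 0 < a) (hb : 0 < b) (hc : 0 < c) (n : ℤ) :
    (ternarySolutions a b c n).Finite := by
  have h := (finiteFibers_mul_sq ha).add ((finiteFibers_mul_sq hb).add (finiteFibers_mul_sq hc)
    (fun x => by positivity) fun x => by positivity) (fun x => by positivity)
    (fun x => by positivity) n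
  refine h.subset fun v hv => ?_
  simp only [ternarySolutions, Set.mem_ofPred_eq] at hv ⊢
  linarith

/-- The solutions on the isotropic line spanned by `(1, 1, 0)` modulo 3. -/
def isotropicPart (n : ℤ) : Set (ℤ × ℤ × ℤ) :=
  ternarySolutions 2 1 1 n ∩ {v | v.2.1 % 3 = v.1 % 3 ∧ v.2.2 % 3 = 0}

/-- The basis of the sublattice is chosen to keep the form diagonal: 2(s + t)² + (s - 2t)² + (3w)² =
3(s² + 2t² + 3w²). -/
lemma sum_isotropicPart (n : ℤ) (W : ℤ → ℤ → ℤ → ZMod 3) :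
    ∑ᶠ v ∈ isotropicPart (3 * n), W v.1 v.2.1 v.2.2 =
      ∑ᶠ v ∈ ternarySolutions 1 2 3 n, W (v.1 + v.2.1) (v.1 - 2 * v.2.1) (3 * v.2.2) := by
  symm
  refine finsum_mem_eq_of_bijOn (fun v => (v.1 + v.2.1, v.1 - 2 * v.2.1, 3 * v.2.2))
    ⟨?_, ?_, ?_⟩ fun _ _ => rfl
  · rintro ⟨s, t, w⟩ h
    simp only [isotropicPart, ternarySolutions, Set.mem_ofPred_eq, Set.mem_inter_iff] at h ⊢
    refine ⟨by linarith, by omega, by omega⟩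
  · rintro ⟨s, t, w⟩ _ ⟨s', t', w'⟩ _ h
    simp only [Prod.ext_iff] at h ⊢
    omega
  · rintro ⟨x, y, z⟩ ⟨h, h1, h2⟩
    simp only [ternarySolutions, Set.mem_ofPred_eq] at h h1 h2
    obtain ⟨t, ht⟩ : (3 : ℤ) ∣ x - y := by omega
    obtain ⟨w, rfl⟩ : (3 : ℤ) ∣ z := by omega
    refine ⟨(x - t, t, w), ?_, ?_⟩
    · obtain rfl : y = x - 3 * t := by omega
      simp only [ternarySolutions, Set.mem_ofPred_eq]
      linarith
    · simp only [Prod.mk.injEq, and_true]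
      omega

/-- The isotropic lines are spanned by (1, ±1, 0) and (1, 0, ±1). The right side counts those
through the vector: one if it is nonzero modulo 3, and four, which is again 1, if it is zero. -/
lemma isotropic_mod_three {x y z : ℤ} (h : (2 * x ^ 2 + 1 * y ^ 2 + 1 * z ^ 2) % 3 = 0) :
    (1 : ZMod 3) = (if y % 3 = x % 3 ∧ z % 3 = 0 then 1 else 0) +
      (if (-y) % 3 = x % 3 ∧ z % 3 = 0 then 1 else 0) +
      ((if z % 3 = x % 3 ∧ y % 3 = 0 then 1 else 0) +
      (if (-z) % 3 = x % 3 ∧ y % 3 = 0 then 1 else 0)) := by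
  have hx : x % 3 = 0 ∨ x % 3 = 1 ∨ x % 3 = 2 := by omega
  have hy : y % 3 = 0 ∨ y % 3 = 1 ∨ y % 3 = 2 := by omega
  have hz : z % 3 = 0 ∨ z % 3 = 1 ∨ z % 3 = 2 := by omega
  have hny : (-y) % 3 = (-(y % 3)) % 3 := by omega
  have hnz : (-z) % 3 = (-(z % 3)) % 3 := by omega
  have e : (2 * x ^ 2 + 1 * y ^ 2 + 1 * z ^ 2) % 3 =
    (2 * (x % 3) ^ 2 + 1 * (y % 3) ^ 2 + 1 * (z % 3) ^ 2) % 3 := by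
    simp [Int.add_emod, Int.mul_emod, pow_two]
  rw [e] at h
  rw [hny, hnz]
  rcases hx with hx | hx | hx <;> rcases hy with hy | hy | hy <;> rcases hz with hz | hz | hz <;>
    rw [hx, hy, hz] at h ⊢ <;> revert h <;> decide

lemma sum_ternarySolutions (n : ℤ) (W : ℤ → ℤ → ℤ → ZMod 3)
    (hneg : ∀ x y z, W x (-y) z = W x y z) (hswap : ∀ x y z, W x z y = W x y z) :
    ∑ᶠ v ∈ ternarySolutions 2 1 1 (3 * n), W v.1 v.2.1 v.2.2 =
      ∑ᶠ v ∈ ternarySolutions 1 2 3 n, W (v.1 + v.2.1) (v.1 - 2 * v.2.1) (3 * v.2.2) := by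
  have hS := finite_ternarySolutions (a := 2) (b := 1) (c := 1) two_pos one_pos one_pos (3 * n)
  -- A symmetry `e` of both the form and the weight carries another isotropic line to the standard
  -- one, so all four lines have the same sum.
  have line : ∀ (e : ℤ × ℤ × ℤ ≃ ℤ × ℤ × ℤ),
      (∀ v, v ∈ ternarySolutions 2 1 1 (3 * n) ↔ e v ∈ ternarySolutions 2 1 1 (3 * n)) →
      (∀ v, W (e v).1 (e v).2.1 (e v).2.2 = W v.1 v.2.1 v.2.2) →
      ∑ v ∈ hS.toFinset, (if (e v).2.1 % 3 = (e v).1 % 3 ∧ (e v).2.2 % 3 = 0 then 1 else 0) *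
        W v.1 v.2.1 v.2.2 = ∑ᶠ v ∈ isotropicPart (3 * n), W v.1 v.2.1 v.2.2 := by
    intro e he hW
    rw [isotropicPart, finsum_mem_eq_finite_toFinset_sum _ (hS.inter_of_left _)]
    simp_rw [ite_mul, one_mul, zero_mul]
    rw [← Finset.sum_filter]
    refine Finset.sum_bij (fun v _ => e v) ?_ ?_ ?_ ?_
    · intro v hv
      rw [mem_filter, Set.Finite.mem_toFinset] at hv
      rw [Set.Finite.mem_toFinset]
      exact ⟨(he v).1 hv.1, hv.2⟩
    · intro a _ b _ h
      exact e.injective h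
    · intro v hv
      rw [Set.Finite.mem_toFinset] at hv
      refine ⟨e.symm v, ?_, by simp⟩
      rw [mem_filter, Set.Finite.mem_toFinset]
      exact ⟨(he _).2 (by simpa using hv.1), by simpa using hv.2⟩
    · intro v _
      exact (hW v).symm
  have l1 := line (Equiv.refl _) (fun v => Iff.rfl) fun v => rfl
  have l2 := line ((Equiv.refl ℤ).prodCongr ((Equiv.neg ℤ).prodCongr (Equiv.refl ℤ)))
    (fun v => by simp [ternarySolutions]) fun v => by simp [hneg]
  have l3 := line ((Equiv.refl ℤ).prodCongr (Equiv.prodComm ℤ ℤ))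
    (fun v => by simp [ternarySolutions, add_right_comm]) fun v => by simp [hswap v.1 v.2.1]
  have l4 := line ((Equiv.refl ℤ).prodCongr ((Equiv.prodComm ℤ ℤ).trans
    ((Equiv.neg ℤ).prodCongr (Equiv.refl ℤ))))
    (fun v => by simp [ternarySolutions, add_right_comm])
    fun v => by simp [hneg, hswap v.1 v.2.1]
  rw [← sum_isotropicPart, finsum_mem_eq_finite_toFinset_sum _ hS]
  have hsplit : ∀ v ∈ hS.toFinset, W v.1 v.2.1 v.2.2 = 1 * W v.1 v.2.1 v.2.2 :=
    fun v _ => (one_mul _).symm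
  have hsplit' : ∀ v ∈ hS.toFinset, (1 : ZMod 3) * W v.1 v.2.1 v.2.2 = _ * W v.1 v.2.1 v.2.2 :=
    fun v hv => congrArg (· * W v.1 v.2.1 v.2.2) <| isotropic_mod_three (x := v.1) (y := v.2.1)
      (z := v.2.2) <| by
        rw [Set.Finite.mem_toFinset] at hv
        simp only [ternarySolutions, Set.mem_ofPred_eq] at hv
        omega
  rw [Finset.sum_congr rfl hsplit, Finset.sum_congr rfl hsplit']
  simp_rw [add_mul]
  simp only [Finset.sum_add_distrib]
  simp only [Equiv.refl_apply, Equiv.prodCongr_apply, Prod.map, Equiv.neg_apply,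
    Equiv.prodComm_apply, Prod.swap, Equiv.trans_apply] at l1 l2 l3 l4
  refine (congrArg₂ _ (congrArg₂ _ l1 l2) (congrArg₂ _ l3 l4)).trans ?_
  -- Four equal contributions amount to one in `ZMod 3`.
  generalize ∑ᶠ v ∈ isotropicPart (3 * n), W v.1 v.2.1 v.2.2 = z
  revert z
  decide

/-! ### Finite forms of Gauss's identities -/

section Shanks

variable {R : Type*} [CommRing R] (x : R)

/-- A truncation of Gauss's identity φ(-x)∏(1 + x^k) = ∏(1 - x^k) with explicit error. The error
terms have order at least n + 1, so they disappear in the limit. -/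
lemma sum_telescoping_squares (n : ℕ) :
    (1 + ∑ s ∈ range n, 2 * (-1) ^ (s + 1) * x ^ (s + 1) ^ 2) * ∏ k ∈ range n, (1 + x ^ (k + 1)) =
      ∏ k ∈ range n, (1 - x ^ (k + 1)) +
        ∑ s ∈ range n, 2 * (-1) ^ (s + 1) * x ^ ((s + 1) * (n + 1)) *
          ((∏ k ∈ Ico (s + 1) n, (1 - x ^ (k + 1))) * ∏ k ∈ range s, (1 + x ^ (k + 1))) := by
  induction n with
  | zero => simp
  | succ n ih =>
    -- Apart from the factor 1 + x^(n+1), passing from n to n + 1 changes the error term s by a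
    -- difference of `Z`. The boundary value `Z n` helps to supply the new square, and `-Z 0` turns
    -- the factor 1 - x^(n+1) of the main product into 1 + x^(n+1).
    set Z : ℕ → R := fun s => 2 * (-1) ^ (s + 1) * x ^ ((s + 1) * (n + 1)) *
      ((∏ k ∈ Ico s n, (1 - x ^ (k + 1))) * ∏ k ∈ range s, (1 + x ^ (k + 1))) with hZ
    have hstep : ∀ s ∈ range n, 2 * (-1) ^ (s + 1) * x ^ ((s + 1) * (n + 1 + 1)) *
          ((∏ k ∈ Ico (s + 1) (n + 1), (1 - x ^ (k + 1))) * ∏ k ∈ range s, (1 + x ^ (k + 1))) =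
        (1 + x ^ (n + 1)) * (2 * (-1) ^ (s + 1) * x ^ ((s + 1) * (n + 1)) *
          ((∏ k ∈ Ico (s + 1) n, (1 - x ^ (k + 1))) * ∏ k ∈ range s, (1 + x ^ (k + 1)))) +
        (Z (s + 1) - Z s) := by
      intro s hs
      rw [mem_range] at hs
      simp only [hZ]
      rw [Finset.prod_Ico_succ_top (by omega), Finset.prod_range_succ,
        Finset.prod_eq_prod_Ico_succ_bot hs]
      generalize ∏ k ∈ Ico (s + 1) n, (1 - x ^ (k + 1)) = A
      generalize ∏ k ∈ range s, (1 + x ^ (k + 1)) = B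
      ring
    rw [sum_range_succ (n := n), sum_range_succ (n := n), prod_range_succ, prod_range_succ,
      sum_congr rfl hstep, sum_add_distrib, ← mul_sum, sum_range_sub]
    have hZ0 : Z 0 = -2 * x ^ (n + 1) * ∏ k ∈ range n, (1 - x ^ (k + 1)) := by
      simp [hZ]
    have hZn : Z n = 2 * (-1) ^ (n + 1) * x ^ ((n + 1) * (n + 1)) *
        ∏ k ∈ range n, (1 + x ^ (k + 1)) := by
      simp [hZ]
    rw [hZ0, hZn, Ico_self, prod_empty]
    linear_combination (1 + x ^ (n + 1)) * ih

/-- The analogue for ψ(x)∏(1 - x^(2k+1)) = ∏(1 - x^(2k+2)). Here the main product is the term s = 0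
on the right, and the terms with s ≥ 1 are the error. -/
lemma sum_telescoping_triangles (n : ℕ) :
    (∑ i ∈ range (2 * n), x ^ (i * (i + 1) / 2)) * ∏ k ∈ range n, (1 - x ^ (2 * k + 1)) =
      ∑ s ∈ range n, x ^ (s * (2 * n + 1)) *
        ((∏ k ∈ Ico s n, (1 - x ^ (2 * k + 2))) * ∏ k ∈ range s, (1 - x ^ (2 * k + 1))) := by
  induction n with
  | zero => simp
  | succ n ih =>
    set Z : ℕ → R := fun s => x ^ (s * (2 * n + 1)) * (1 - x ^ (2 * s)) *
      ((∏ k ∈ Ico s n, (1 - x ^ (2 * k + 2))) * ∏ k ∈ range s, (1 - x ^ (2 * k + 1))) with hZ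
    have hstep : ∀ s ∈ range n, x ^ (s * (2 * (n + 1) + 1)) *
        ((∏ k ∈ Ico s (n + 1), (1 - x ^ (2 * k + 2))) * ∏ k ∈ range s, (1 - x ^ (2 * k + 1))) =
        (1 - x ^ (2 * n + 1)) * (x ^ (s * (2 * n + 1)) *
        ((∏ k ∈ Ico s n, (1 - x ^ (2 * k + 2))) * ∏ k ∈ range s, (1 - x ^ (2 * k + 1)))) +
        (Z (s + 1) - Z s) := by
      intro s hs
      rw [mem_range] at hs
      simp only [hZ]
      rw [Finset.prod_Ico_succ_top (by omega), Finset.prod_range_succ,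
        Finset.prod_eq_prod_Ico_succ_bot hs]
      generalize ∏ k ∈ Ico (s + 1) n, (1 - x ^ (2 * k + 2)) = A
      generalize ∏ k ∈ range s, (1 - x ^ (2 * k + 1)) = B
      ring
    rw [show 2 * (n + 1) = 2 * n + 1 + 1 by ring, sum_range_succ, sum_range_succ (n := 2 * n),
      sum_range_succ (n := n), prod_range_succ, show 2 * n + 1 + 1 = 2 * (n + 1) by ring,
      sum_congr rfl hstep, sum_add_distrib, ← mul_sum, sum_range_sub]
    have e1 : 2 * n * (2 * n + 1) / 2 = n * (2 * n + 1) := by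
      rw [mul_assoc, Nat.mul_div_cancel_left _ two_pos]
    have e2 : (2 * n + 1) * (2 * (n + 1)) / 2 = (n + 1) * (2 * n + 1) := by
      rw [mul_left_comm, Nat.mul_div_cancel_left _ two_pos, mul_comm]
    have hZ0 : Z 0 = 0 := by simp [hZ]
    have hZn : Z n = x ^ (n * (2 * n + 1)) * (1 - x ^ (2 * n)) *
        ∏ k ∈ range n, (1 - x ^ (2 * k + 1)) := by
      simp [hZ]
    rw [hZ0, hZn, e1, e2, Nat.Ico_succ_singleton,
      prod_singleton]
    linear_combination (1 - x ^ (2 * n + 1)) * ih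

end Shanks

/-! ### Gauss's identities as power series -/

section Gauss

open PowerSeries Filter Topology
open scoped PowerSeries.WithPiTopology

lemma multipliable_one_add_mul_X_pow (a : PowerSeries (ZMod 3)) {g : ℕ → ℕ} (hg : ∀ k, k < g k) :
    Multipliable fun k => 1 + a * X ^ g k := by
  apply WithPiTopology.multipliable_one_add_of_tendsto_order_atTop_nhds_top
  refine ENat.tendsto_nhds_top_iff_natCast_lt.mpr fun n => eventually_atTop.mpr ⟨n, fun m hm => ?_⟩
  have h1 : ((g m : ℕ) : ℕ∞) ≤ (a * X ^ g m).order := by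
    refine le_trans ?_ (le_order_mul a _)
    rw [order_X_pow]
    exact le_add_self
  refine lt_of_lt_of_le ?_ h1
  have := hg m
  exact_mod_cast (by omega : n < g m)

lemma multipliable_one_add_X_pow {g : ℕ → ℕ} (hg : ∀ k, k < g k) :
    Multipliable fun k => 1 + (X : PowerSeries (ZMod 3)) ^ g k := by
  simpa using multipliable_one_add_mul_X_pow 1 hg

lemma multipliable_one_sub_X_pow {g : ℕ → ℕ} (hg : ∀ k, k < g k) :
    Multipliable fun k => 1 - (X : PowerSeries (ZMod 3)) ^ g k := by
  simpa [sub_eq_add_neg] using multipliable_one_add_mul_X_pow (-1) hg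

lemma tprod_ne_zero_of_constantCoeff {f : ℕ → PowerSeries (ZMod 3)} (hf : Multipliable f)
    (h : ∀ k, constantCoeff (f k) = 1) : ∏' k, f k ≠ 0 := by
  intro h0
  have := hf.map_tprod (constantCoeff (R := ZMod 3)) (WithPiTopology.continuous_constantCoeff _)
  rw [h0] at this
  simp [h] at this

lemma tendsto_zero_of_X_pow_dvd {f : ℕ → PowerSeries (ZMod 3)} (h : ∀ n, X ^ n ∣ f n) :
    Tendsto f atTop (𝓝 0) := by
  rw [WithPiTopology.tendsto_iff_coeff_tendsto]
  intro d
  refine tendsto_atTop_of_eventually_const (i₀ := d + 1) fun n hn => ?_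
  rw [map_zero]
  exact X_pow_dvd_iff.1 (h n) d (by omega)

lemma coeff_phiMinus {c : ℕ} (hc : 0 < c) {n d : ℕ} (hd : d ≤ n) :
    (phiMinus c).coeff d = (1 + ∑ s ∈ range n,
      2 * (-1) ^ (s + 1) * ((X : PowerSeries (ZMod 3)) ^ c) ^ (s + 1) ^ 2).coeff d := by
  have hfin := finiteFibers_mul_sq (c := (c : ℤ)) (by exact_mod_cast hc) d
  have hterm : ∀ s : ℕ, (2 * (-1) ^ (s + 1) * ((X : PowerSeries (ZMod 3)) ^ c) ^ (s + 1) ^ 2).coeff d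
      = if d = c * (s + 1) ^ 2 then 2 * (-1) ^ (s + 1) else 0 := by
    intro s
    rw [show (2 * (-1) ^ (s + 1) : PowerSeries (ZMod 3)) = C (2 * (-1) ^ (s + 1)) by
        rw [map_mul, map_pow, map_neg, map_one, map_ofNat],
      ← pow_mul, coeff_C_mul, coeff_X_pow]
    simp
  have hpos : ∑ᶠ x ∈ {x : ℤ | (c : ℤ) * x ^ 2 = (d : ℤ)} ∩ {x | 0 < x}, paritySign x =
      ∑ s ∈ range n with d = c * (s + 1) ^ 2, (-1) ^ (s + 1) := by
    rw [← finsum_mem_coe_finset]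
    symm
    refine finsum_mem_eq_of_bijOn (fun s : ℕ => (s : ℤ) + 1) ⟨?_, ?_, ?_⟩ ?_
    · intro s hs
      simp only [coe_filter, mem_range, Set.mem_ofPred_eq, Set.mem_inter_iff] at hs ⊢
      refine ⟨?_, by omega⟩
      rw [hs.2]
      push_cast
      rfl
    · intro s _ t _ h
      simpa using h
    · rintro x ⟨h, h0⟩
      simp only [Set.mem_ofPred_eq] at h h0
      obtain ⟨s, rfl⟩ : ∃ s : ℕ, x = s + 1 := ⟨(x - 1).toNat, by omega⟩
      refine ⟨s, ?_, rfl⟩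
      simp only [coe_filter, mem_range, Set.mem_ofPred_eq]
      have hh : d = c * (s + 1) ^ 2 := by exact_mod_cast h.symm
      exact ⟨by nlinarith, hh⟩
    · intro s _
      unfold paritySign
      rcases Nat.even_or_odd (s + 1) with h | h
      · rw [h.neg_one_pow, if_pos (by exact_mod_cast h)]
      · rw [h.neg_one_pow, if_neg (by rw [Int.not_even_iff_odd]; exact_mod_cast h)]
  have hneg : ∑ᶠ x ∈ {x : ℤ | (c : ℤ) * x ^ 2 = (d : ℤ)} ∩ {x | ¬ 0 < x} ∩ {x | x < 0},
      paritySign x =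
      ∑ᶠ x ∈ {x : ℤ | (c : ℤ) * x ^ 2 = (d : ℤ)} ∩ {x | 0 < x}, paritySign x := by
    refine finsum_mem_eq_of_bijOn (fun x => -x) ⟨?_, neg_injective.injOn, ?_⟩
      fun x _ => (paritySign_neg x).symm
    · rintro x ⟨⟨h, _⟩, h'⟩
      simp only [Set.mem_ofPred_eq, Set.mem_inter_iff] at h h' ⊢
      exact ⟨by rwa [neg_sq], by omega⟩
    · rintro x ⟨h, h'⟩
      simp only [Set.mem_ofPred_eq] at h h'
      refine ⟨-x, ⟨⟨?_, ?_⟩, ?_⟩, by simp⟩ <;> simp only [Set.mem_ofPred_eq]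
      · rwa [neg_sq]
      · omega
      · omega
  have hzero : ∑ᶠ x ∈ {x : ℤ | (c : ℤ) * x ^ 2 = (d : ℤ)} ∩ {x | ¬ 0 < x} ∩ {x | ¬ x < 0},
      paritySign x = if d = 0 then 1 else 0 := by
    split_ifs with h
    · rw [finsum_mem_congr (t := {0}) (g := paritySign) _ fun _ _ => rfl, finsum_mem_singleton]
      · simp [paritySign]
      · subst h
        ext x
        simp only [Set.mem_inter_iff, Set.mem_ofPred_eq, Set.mem_singleton_iff]
        constructor
        · omega
        · rintro rfl
          simp
    · apply finsum_mem_eq_zero_of_forall_eq_zero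
      rintro x ⟨⟨h1, h2⟩, h3⟩
      simp only [Set.mem_ofPred_eq] at h1 h2 h3
      obtain rfl : x = 0 := by omega
      simp at h1
      omega
  rw [phiMinus, coeff_thetaSeries, finsum_mem_eq_sum_parts hfin fun x => 0 < x,
    finsum_mem_eq_sum_parts (hfin.inter_of_left {x | ¬ 0 < x}) fun x => x < 0, hneg, hzero, hpos, map_add,
    map_sum, coeff_one, Finset.sum_congr rfl fun s _ => hterm s, ← Finset.sum_filter,
    ← Finset.mul_sum]
  ring

lemma gauss_phi {c : ℕ} (hc : 0 < c) :
    phiMinus c * ∏' k, (1 + X ^ (c * (k + 1))) = ∏' k, (1 - X ^ (c * (k + 1))) := by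
  have hg : ∀ k, k < c * (k + 1) := fun k => by nlinarith
  have hD := (multipliable_one_add_X_pow hg).tendsto_prod_tprod_nat
  have hE := (multipliable_one_sub_X_pow hg).tendsto_prod_tprod_nat
  have hS : Tendsto (fun n => 1 + ∑ s ∈ range n,
      2 * (-1) ^ (s + 1) * ((X : PowerSeries (ZMod 3)) ^ c) ^ (s + 1) ^ 2) atTop
      (𝓝 (phiMinus c)) := by
    rw [WithPiTopology.tendsto_iff_coeff_tendsto]
    exact fun d => tendsto_atTop_of_eventually_const (i₀ := d) fun n hn =>
      (coeff_phiMinus hc hn).symm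
  have hR := hE.add (tendsto_zero_of_X_pow_dvd (f := fun n => ∑ s ∈ range n,
    2 * (-1) ^ (s + 1) * (X ^ c) ^ ((s + 1) * (n + 1)) *
      ((∏ k ∈ Ico (s + 1) n, (1 - (X ^ c) ^ (k + 1))) *
        ∏ k ∈ range s, (1 + (X ^ c) ^ (k + 1)))) fun n => by
    refine Finset.dvd_sum fun s _ => ((Dvd.dvd.mul_left ?_ _).mul_right _)
    rw [← pow_mul, ← mul_assoc]
    have : 0 < c * (s + 1) := Nat.mul_pos hc s.succ_pos
    exact pow_dvd_pow _ (by nlinarith))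
  rw [add_zero] at hR
  refine tendsto_nhds_unique (hS.mul hD) (hR.congr fun n => ?_)
  have := sum_telescoping_squares ((X : PowerSeries (ZMod 3)) ^ c) n
  simp only [← pow_mul] at this ⊢
  exact this.symm

lemma coeff_psiSum {n d : ℕ} (hd : d ≤ n) :
    (evalNegHom (-psiSum 1)).coeff d =
      (∑ i ∈ range (2 * (n + 1)), (-X : PowerSeries (ZMod 3)) ^ (i * (i + 1) / 2)).coeff d := by
  have hfin := finiteFibers_mul_triangular one_pos d
  have htri : ∀ i : ℕ, triangular i = ((i * (i + 1) / 2 : ℕ) : ℤ) := fun i => by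
    rw [triangular]
    push_cast
    rfl
  have hreflect : ∀ k : ℤ, triangular (-1 - k) = triangular k := fun k => by
    rw [triangular, triangular]; ring_nf
  have hterm : ∀ i : ℕ, ((-X : PowerSeries (ZMod 3)) ^ (i * (i + 1) / 2)).coeff d
      = (-1) ^ d * if d = i * (i + 1) / 2 then 1 else 0 := by
    intro i
    rw [← evalNegHom_X, ← map_pow, evalNegHom, coeff_rescale, coeff_X_pow]
  have hpos : ∑ᶠ x ∈ {x : ℤ | 1 * triangular x = (d : ℤ)} ∩ {x | 0 ≤ x}, (1 : ℤ → ZMod 3) x =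
      ∑ i ∈ range (2 * (n + 1)) with d = i * (i + 1) / 2, 1 := by
    rw [← finsum_mem_coe_finset]
    symm
    refine finsum_mem_eq_of_bijOn (fun s : ℕ => (s : ℤ)) ⟨?_, ?_, ?_⟩ fun _ _ => rfl
    · intro s hs
      simp only [coe_filter, mem_range, Set.mem_ofPred_eq, Set.mem_inter_iff] at hs ⊢
      exact ⟨by rw [one_mul, htri, ← hs.2], by omega⟩
    · intro s _ t _ h
      simpa using h
    · rintro x ⟨h, h0⟩
      simp only [Set.mem_ofPred_eq] at h h0
      lift x to ℕ using h0 with s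
      refine ⟨s, ?_, rfl⟩
      have h2 := two_mul_triangular s
      rw [one_mul] at h
      simp only [coe_filter, mem_range, Set.mem_ofPred_eq]
      refine ⟨?_, by rw [htri] at h; exact_mod_cast h.symm⟩
      by_contra hh
      have : (2 * (n + 1) : ℤ) ≤ s := by exact_mod_cast not_lt.1 hh
      have : (d : ℤ) ≤ n := by exact_mod_cast hd
      nlinarith
  have hneg : ∑ᶠ x ∈ {x : ℤ | 1 * triangular x = (d : ℤ)} ∩ {x | ¬ 0 ≤ x}, (1 : ℤ → ZMod 3) x =
      ∑ᶠ x ∈ {x : ℤ | 1 * triangular x = (d : ℤ)} ∩ {x | 0 ≤ x}, (1 : ℤ → ZMod 3) x := by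
    refine finsum_mem_eq_of_bijOn (fun x => -1 - x) ⟨?_, ?_, ?_⟩ fun _ _ => rfl
    · rintro x ⟨h, h'⟩
      simp only [Set.mem_ofPred_eq, Set.mem_inter_iff, hreflect] at h h' ⊢
      exact ⟨h, by omega⟩
    · intro x _ y _ h
      simpa using h
    · rintro x ⟨h, h'⟩
      refine ⟨-1 - x, ?_, by simp⟩
      simp only [Set.mem_ofPred_eq, Set.mem_inter_iff, hreflect] at h h' ⊢
      exact ⟨h, by omega⟩
  rw [evalNegHom, coeff_rescale, map_neg, psiSum, coeff_thetaSeries,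
    finsum_mem_eq_sum_parts hfin fun x => 0 ≤ x, hneg, hpos, map_sum,
    Finset.sum_congr rfl fun i _ => hterm i, ← Finset.mul_sum, ← Finset.sum_filter]
  congr 1
  -- `psiSum` counts each triangular number twice, and -2 = 1 in `ZMod 3`; hence `-psiSum 1` is
  -- exactly ψ.
  generalize ∑ i ∈ range (2 * (n + 1)) with d = i * (i + 1) / 2, (1 : ZMod 3) = z
  revert z
  decide

lemma gauss_psi :
    evalNegHom (-psiSum 1) * ∏' k, (1 + X ^ (2 * k + 1)) = ∏' k, (1 - X ^ (2 * k + 2)) := by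
  have hD := (multipliable_one_add_X_pow (g := fun k => 2 * k + 1)
    fun k => by omega).tendsto_prod_tprod_nat
  have hE := (multipliable_one_sub_X_pow (g := fun k => 2 * k + 2)
    fun k => by omega).tendsto_prod_tprod_nat
  have hS : Tendsto (fun n => ∑ i ∈ range (2 * n),
      (-X : PowerSeries (ZMod 3)) ^ (i * (i + 1) / 2)) atTop (𝓝 (evalNegHom (-psiSum 1))) := by
    rw [WithPiTopology.tendsto_iff_coeff_tendsto]
    refine fun d => tendsto_atTop_of_eventually_const (i₀ := d + 1) fun n hn => ?_
    obtain ⟨m, rfl⟩ : ∃ m, n = m + 1 := ⟨n - 1, by omega⟩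
    exact (coeff_psiSum (by omega)).symm
  -- The sum starts at 1 because the term s = 0 is the main product, already in `hE`.
  have hR := hE.add (tendsto_zero_of_X_pow_dvd (f := fun n => ∑ s ∈ Ico 1 n,
    (-X) ^ (s * (2 * n + 1)) * ((∏ k ∈ Ico s n, (1 - (-X) ^ (2 * k + 2))) *
      ∏ k ∈ range s, (1 - (-X) ^ (2 * k + 1)))) fun n => by
    refine Finset.dvd_sum fun s hs => Dvd.dvd.mul_right ?_ _
    rw [neg_pow]
    rw [mem_Ico] at hs
    exact (pow_dvd_pow _ (by nlinarith)).mul_left _)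
  rw [add_zero] at hR
  refine tendsto_nhds_unique (hS.mul hD) ((tendsto_congr' ?_).1 hR)
  filter_upwards [eventually_gt_atTop 0] with n hn
  have := sum_telescoping_triangles (-X : PowerSeries (ZMod 3)) n
  rw [range_eq_Ico (a := n), Finset.sum_eq_sum_Ico_succ_bot hn] at this
  have e1 : ∀ k : ℕ, (-X : PowerSeries (ZMod 3)) ^ (2 * k + 2) = X ^ (2 * k + 2) := fun k =>
    Even.neg_pow (by simp [parity_simps]) _
  have e2 : ∀ k : ℕ, (-X : PowerSeries (ZMod 3)) ^ (2 * k + 1) = -X ^ (2 * k + 1) := fun k =>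
    Odd.neg_pow (by simp [parity_simps]) _
  simp only [e1, e2, sub_neg_eq_add, ← range_eq_Ico, zero_mul, pow_zero, one_mul, range_zero,
    prod_empty, mul_one, zero_add] at this ⊢
  exact this.symm

end Gauss

/-! ### Generating functions of the two partition functions -/

section GenFun

open PowerSeries Filter Topology
open scoped PowerSeries.WithPiTopology

lemma hasProd_ite_odd {u : ℕ → PowerSeries (ZMod 3)} (h : Multipliable fun k => u (2 * k + 1)) :
    HasProd (fun i => if Odd (i + 1) then u (i + 1) else 1) (∏' k, u (2 * k + 1)) := by
  rw [← mul_one (∏' k, u (2 * k + 1))]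
  refine HasProd.even_mul_odd ?_ ?_
  · convert h.hasProd using 2 with k
    rw [if_pos (by simp [parity_simps])]
  · convert hasProd_one using 2 with k
    rw [if_neg (by simp [parity_simps])]

lemma hasProd_ite_even {u : ℕ → PowerSeries (ZMod 3)} (h : Multipliable fun k => u (2 * k + 2)) :
    HasProd (fun i => if Even (i + 1) then u (i + 1) else 1) (∏' k, u (2 * k + 2)) := by
  rw [← one_mul (∏' k, u (2 * k + 2))]
  refine HasProd.even_mul_odd ?_ ?_
  · convert hasProd_one using 2 with k
    rw [if_neg (by simp [parity_simps])]
  · convert h.hasProd using 2 with k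
    rw [if_pos (by simp [parity_simps])]

lemma tprod_eq_odd_mul_even {u : ℕ → PowerSeries (ZMod 3)}
    (ho : Multipliable fun k => u (2 * k + 1)) (he : Multipliable fun k => u (2 * k + 2)) :
    ∏' k, u (1 * (k + 1)) = (∏' k, u (2 * k + 1)) * ∏' k, u (2 * k + 2) := by
  simp_rw [one_mul]
  exact (tprod_even_mul_odd (f := fun k => u (k + 1)) ho he).symm

lemma one_sub_X_pow_mul_tsum {m : ℕ} (hm : 0 < m) :
    (1 - X ^ m) * ∑' j : ℕ, (X : PowerSeries (ZMod 3)) ^ (m * (j + 1)) = X ^ m := by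
  have h0 : constantCoeff ((X : PowerSeries (ZMod 3)) ^ m) = 0 := by
    simp [hm.ne']
  have h1 : ∀ j : ℕ, (X : PowerSeries (ZMod 3)) ^ (m * (j + 1)) = X ^ m * (X ^ m) ^ j := by
    intro j
    ring
  simp_rw [h1]
  rw [(WithPiTopology.summable_pow_of_constantCoeff_eq_zero h0).tsum_mul_left, mul_left_comm,
    WithPiTopology.one_sub_mul_tsum_pow_of_constantCoeff_eq_zero h0, mul_one]

/-- The generating function of overpartitions into odd parts, modulo 3. -/
noncomputable def poBarSeries : PowerSeries (ZMod 3) := PowerSeries.mk fun n => (poBar n : ZMod 3)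

/-- The generating function of partitions without repeated even parts, modulo 3. -/
noncomputable def pedSeries : PowerSeries (ZMod 3) := PowerSeries.mk fun n => (ped n : ZMod 3)

/-- Each part size that occurs may be overlined or not, whence the weight 2 per distinct odd size.
-/
lemma poBarSeries_eq_genFun :
    poBarSeries = Nat.Partition.genFun fun i _ => if Odd i then 2 else 0 := by
  ext n
  rw [poBarSeries, coeff_mk, Nat.Partition.coeff_genFun, poBar, overpartitions, card_filter,
    sum_sigma, Nat.cast_sum]
  refine Finset.sum_congr rfl fun π _ => ?_
  rw [Finsupp.prod, Multiset.toFinsupp_support, prod_ite_zero]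
  simp only [Multiset.mem_toFinset]
  split_ifs with h <;> simp [h]

lemma pedSeries_eq_genFun :
    pedSeries = Nat.Partition.genFun fun i c => if Even i → c = 1 then 1 else 0 := by
  ext n
  rw [pedSeries, coeff_mk, Nat.Partition.coeff_genFun, ped, card_filter, Nat.cast_sum]
  refine Finset.sum_congr rfl fun π _ => ?_
  rw [Finsupp.prod, Multiset.toFinsupp_support, prod_boole]
  simp

/-- The factor of an odd size m is 1 + 2(q^m + q^(2m) + ⋯) = (1 + q^m)/(1 - q^m). -/
lemma poBarSeries_mul_tprod :
    poBarSeries * ∏' k, (1 - X ^ (2 * k + 1)) = ∏' k, (1 + X ^ (2 * k + 1)) := by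
  have hO := hasProd_ite_odd (u := fun m => 1 - (X : PowerSeries (ZMod 3)) ^ m)
    (multipliable_one_sub_X_pow fun k => by omega)
  have hD := hasProd_ite_odd (u := fun m => 1 + (X : PowerSeries (ZMod 3)) ^ m)
    (multipliable_one_add_X_pow fun k => by omega)
  have hP := Nat.Partition.hasProd_genFun (R := ZMod 3) fun i _ => if Odd i then 2 else 0
  rw [← poBarSeries_eq_genFun] at hP
  refine (hP.mul hO).unique ?_
  convert hD using 2 with i
  · rfl
  split_ifs with h
  · have := one_sub_X_pow_mul_tsum (m := i + 1) i.succ_pos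
    have h2 : ∀ j : ℕ, (2 : ZMod 3) • (X : PowerSeries (ZMod 3)) ^ ((i + 1) * (j + 1)) =
        X ^ ((i + 1) * (j + 1)) + X ^ ((i + 1) * (j + 1)) := fun j => by
      rw [two_smul]
    have hs : Summable fun j : ℕ => (X : PowerSeries (ZMod 3)) ^ ((i + 1) * (j + 1)) := by
      simpa using Nat.Partition.summable_genFun_term (R := ZMod 3) (fun _ _ => 1) i
    simp_rw [h2]
    rw [hs.tsum_add hs]
    linear_combination 2 * this
  · simp

lemma pedSeries_mul_tprod :
    pedSeries * ∏' k, (1 - X ^ (2 * k + 1)) = ∏' k, (1 + X ^ (2 * k + 2)) := by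
  have hO := hasProd_ite_odd (u := fun m => 1 - (X : PowerSeries (ZMod 3)) ^ m)
    (multipliable_one_sub_X_pow fun k => by omega)
  have hD := hasProd_ite_even (u := fun m => 1 + (X : PowerSeries (ZMod 3)) ^ m)
    (multipliable_one_add_X_pow fun k => by omega)
  have hP := Nat.Partition.hasProd_genFun (R := ZMod 3) fun i c => if Even i → c = 1 then 1 else 0
  rw [← pedSeries_eq_genFun] at hP
  refine (hP.mul hO).unique ?_
  convert hD using 2 with i
  · rfl
  by_cases h : Even (i + 1)
  · rw [if_neg (Nat.not_odd_iff_even.2 h), if_pos h, mul_one, tsum_eq_single 0]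
    · simp
    · intro j hj
      simp [h, hj]
  · have := one_sub_X_pow_mul_tsum (m := i + 1) i.succ_pos
    simp only [h, if_false, Nat.not_even_iff_odd.1 h, if_true, false_imp_iff, one_smul]
    linear_combination this

lemma tprod_factors_ne_zero :
    (∏' k, (1 - (X : PowerSeries (ZMod 3)) ^ (2 * k + 1)) ≠ 0) ∧
    (∏' k, (1 + (X : PowerSeries (ZMod 3)) ^ (2 * k + 1)) ≠ 0) ∧
    (∏' k, (1 + (X : PowerSeries (ZMod 3)) ^ (2 * k + 2)) ≠ 0) := by
  refine ⟨tprod_ne_zero_of_constantCoeff (multipliable_one_sub_X_pow fun k => by omega) ?_,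
    tprod_ne_zero_of_constantCoeff (multipliable_one_add_X_pow fun k => by omega) ?_,
    tprod_ne_zero_of_constantCoeff (multipliable_one_add_X_pow fun k => by omega) ?_⟩ <;> simp

lemma phiMinus_one_mul_tprod :
    phiMinus 1 * ((∏' k, (1 + X ^ (2 * k + 1))) * ∏' k, (1 + X ^ (2 * k + 2))) =
      (∏' k, (1 - X ^ (2 * k + 1))) * ∏' k, (1 - X ^ (2 * k + 2)) := by
  have h := gauss_phi one_pos
  rw [tprod_eq_odd_mul_even (u := fun m => 1 + (X : PowerSeries (ZMod 3)) ^ m)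
      (multipliable_one_add_X_pow fun k => by omega)
      (multipliable_one_add_X_pow fun k => by omega),
    tprod_eq_odd_mul_even (u := fun m => 1 - (X : PowerSeries (ZMod 3)) ^ m)
      (multipliable_one_sub_X_pow fun k => by omega)
      (multipliable_one_sub_X_pow fun k => by omega)] at h
  simpa using h

lemma poBarSeries_mul_phiMinus : poBarSeries * phiMinus 1 = phiMinus 2 := by
  obtain ⟨h1, h2, h3⟩ := tprod_factors_ne_zero
  have hphi := phiMinus_one_mul_tprod
  have hphi2 : phiMinus 2 * ∏' k, (1 + X ^ (2 * k + 2)) = ∏' k, (1 - X ^ (2 * k + 2)) := by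
    simpa [mul_add] using gauss_phi two_pos
  have hP := poBarSeries_mul_tprod
  generalize ∏' k, (1 - (X : PowerSeries (ZMod 3)) ^ (2 * k + 1)) = Eo at *
  generalize ∏' k, (1 + (X : PowerSeries (ZMod 3)) ^ (2 * k + 1)) = Do at *
  generalize ∏' k, (1 - (X : PowerSeries (ZMod 3)) ^ (2 * k + 2)) = Ee at *
  generalize ∏' k, (1 + (X : PowerSeries (ZMod 3)) ^ (2 * k + 2)) = De at *
  apply mul_right_cancel₀ (mul_ne_zero (mul_ne_zero h1 h2) h3)
  linear_combination (poBarSeries * Eo) * hphi - Eo * Do * hphi2 + Eo * Ee * hP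

lemma pedSeries_mul_phiMinus : pedSeries * phiMinus 1 = evalNegHom (-psiSum 1) := by
  obtain ⟨h1, h2, h3⟩ := tprod_factors_ne_zero
  have hphi := phiMinus_one_mul_tprod
  have hpsi := gauss_psi
  have hP := pedSeries_mul_tprod
  generalize ∏' k, (1 - (X : PowerSeries (ZMod 3)) ^ (2 * k + 1)) = Eo at *
  generalize ∏' k, (1 + (X : PowerSeries (ZMod 3)) ^ (2 * k + 1)) = Do at *
  generalize ∏' k, (1 - (X : PowerSeries (ZMod 3)) ^ (2 * k + 2)) = Ee at *
  generalize ∏' k, (1 + (X : PowerSeries (ZMod 3)) ^ (2 * k + 2)) = De at *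
  apply mul_right_cancel₀ (mul_ne_zero (mul_ne_zero h1 h2) h3)
  linear_combination (pedSeries * Eo) * hphi - Eo * De * hpsi + Eo * Ee * hP

lemma evalNegHom_phiMinus : evalNegHom (phiMinus 1) = phiPlus 1 := by
  ext n
  rw [evalNegHom, coeff_rescale, phiMinus, phiPlus, coeff_thetaSeries, coeff_thetaSeries,
    ← smul_eq_mul, smul_finsum_mem (by exact finiteFibers_mul_sq one_pos n)]
  refine finsum_mem_congr rfl fun x hx => ?_
  simp only [Set.mem_ofPred_eq, one_mul] at hx
  have hpar : Even x ↔ Even n := by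
    rw [← Int.even_coe_nat, ← hx, Int.even_pow' two_ne_zero]
  rw [smul_eq_mul, paritySign, Pi.one_apply]
  rcases Nat.even_or_odd n with h | h
  · rw [h.neg_one_pow, if_pos (hpar.2 h), one_mul]
  · rw [h.neg_one_pow, if_neg (by rwa [hpar, Nat.not_even_iff_odd])]
    norm_num

lemma evalNegHom_evalNegHom (f : PowerSeries (ZMod 3)) : evalNegHom (evalNegHom f) = f := by
  ext n
  rw [evalNegHom, coeff_rescale, coeff_rescale, ← mul_assoc, ← mul_pow]
  simp

lemma evalNegHom_pedSeries_mul_phiPlus : evalNegHom pedSeries * phiPlus 1 = -psiSum 1 := by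
  rw [← evalNegHom_phiMinus, ← map_mul, pedSeries_mul_phiMinus, evalNegHom_evalNegHom]

end GenFun

/-! ### Arithmetic progressions modulo 3 -/

/-- The series `∑ c (3 n + r) X ^ n` attached to `∑ c n X ^ n`. -/
noncomputable def progression (r : ℕ) (f : PowerSeries (ZMod 3)) : PowerSeries (ZMod 3) :=
  PowerSeries.mk fun n => f.coeff (3 * n + r)

lemma coeff_progression (r n : ℕ) (f : PowerSeries (ZMod 3)) :
    (progression r f).coeff n = f.coeff (3 * n + r) :=
  PowerSeries.coeff_mk _ _

/-- `g ^ 3` is g(q³), supported on multiples of 3, so in the convolution only the exponents of `f`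
congruent to `r` matter. -/
lemma progression_mul_pow_three {r : ℕ} (hr : r < 3) (f g : PowerSeries (ZMod 3)) :
    progression r (f * g ^ 3) = progression r f * g := by
  ext n
  rw [coeff_progression, ← expand_three_eq_pow, PowerSeries.coeff_mul, PowerSeries.coeff_mul]
  symm
  refine Finset.sum_of_injOn (fun p => (3 * p.1 + r, 3 * p.2)) ?_ ?_ ?_ ?_
  · rintro ⟨a, b⟩ _ ⟨a', b'⟩ _ h
    simp only [Prod.mk.injEq] at h ⊢
    omega
  · rintro ⟨a, b⟩ h
    simp only [mem_coe, HasAntidiagonal.mem_antidiagonal] at h ⊢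
    omega
  · rintro ⟨a, b⟩ h h'
    rw [HasAntidiagonal.mem_antidiagonal] at h
    rw [PowerSeries.coeff_expand_of_not_dvd, mul_zero]
    rintro ⟨c, rfl⟩
    refine h' ⟨((a - r) / 3, c), ?_, ?_⟩
    · simp only [mem_coe, HasAntidiagonal.mem_antidiagonal]
      omega
    · simp only [Prod.mk.injEq, and_true]
      omega
  · rintro ⟨a, b⟩ _
    rw [PowerSeries.coeff_expand_mul, coeff_progression]

lemma phiMinus_one_ne_zero : phiMinus 1 ≠ 0 := by
  intro h
  have := coeff_phiMinus one_pos (le_refl 0)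
  simp [h] at this

lemma phiPlus_one_ne_zero : phiPlus 1 ≠ 0 := by
  rw [← evalNegHom_phiMinus]
  intro h
  apply phiMinus_one_ne_zero
  rw [← evalNegHom_evalNegHom (phiMinus 1), h, map_zero]

lemma progression_phiMinus :
    progression 0 (phiMinus 2 * (phiMinus 1 * phiMinus 1)) =
      phiPlus 1 * (phiMinus 2 * phiMinus 3) := by
  have h1 := finiteFibers_mul_sq one_pos
  have h2 := finiteFibers_mul_sq two_pos
  have h3 := finiteFibers_mul_sq three_pos
  have n1 : ∀ x : ℤ, 0 ≤ 1 * x ^ 2 := fun x => by positivity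
  have n2 : ∀ x : ℤ, 0 ≤ 2 * x ^ 2 := fun x => by positivity
  have n3 : ∀ x : ℤ, 0 ≤ 3 * x ^ 2 := fun x => by positivity
  rw [phiMinus, phiMinus, phiMinus, phiPlus, thetaSeries_mul h1 h1 n1 n1,
    thetaSeries_mul h2 (h1.add h1 n1 n1) n2 fun p => add_nonneg (n1 _) (n1 _),
    thetaSeries_mul h2 h3 n2 n3,
    thetaSeries_mul h1 (h2.add h3 n2 n3) n1 fun p => add_nonneg (n2 _) (n3 _)]
  ext n
  rw [coeff_progression, coeff_thetaSeries, coeff_thetaSeries]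
  have key := sum_ternarySolutions n (fun x y z => paritySign x * (paritySign y * paritySign z))
    (fun x y z => by rw [paritySign_neg]) fun x y z => by rw [mul_comm (paritySign z)]
  convert key using 1
  · refine finsum_mem_congr ?_ fun _ _ => rfl
    ext v
    simp only [ternarySolutions, Set.mem_ofPred_eq]
    push_cast
    constructor <;> intro h <;> linarith
  · refine finsum_mem_congr ?_ fun v _ => ?_
    · ext v
      simp only [ternarySolutions, Set.mem_ofPred_eq]
      constructor <;> intro h <;> linarith
    · have e3 : paritySign (3 * v.2.2) = paritySign v.2.2 := by
        rw [show 3 * v.2.2 = 2 * v.2.2 + v.2.2 by ring, paritySign_add, paritySign_two_mul, one_mul]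
      rw [paritySign_add, paritySign_sub, paritySign_two_mul, e3, Pi.one_apply]
      linear_combination (-paritySign v.2.1 * paritySign v.2.2) * paritySign_mul_self v.1

lemma finsum_mem_indicator {α : Type*} {s : Set α} (hs : s.Finite) (p : α → Prop)
    [DecidablePred p] :
    ∑ᶠ i ∈ s, (if p i then (1 : ZMod 3) else 0) = ∑ᶠ i ∈ s ∩ {i | p i}, 1 := by
  rw [finsum_mem_eq_sum_parts hs p, finsum_mem_eq_zero_of_forall_eq_zero (s := s ∩ {i | ¬ p i}),
    add_zero]
  · exact finsum_mem_congr rfl fun i hi => if_pos hi.2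
  · exact fun i hi => if_neg hi.2

/-- Multiplying k(k+1)/2 + y² + z² = 3n + 1 by 16 and completing the square gives 2(2k+1)² + (4y)² +
(4z)² = 3(16n + 6). The parity and divisibility conditions become a weight invariant under the
symmetries required by `sum_ternarySolutions`. -/
lemma progression_psiSum :
    progression 1 (psiSum 1 * (phiPlus 1 * phiPlus 1)) =
      psiSum 1 * (psiSum 2 * phiPlus 3) := by
  have h1 := finiteFibers_mul_sq one_pos
  have h3 := finiteFibers_mul_sq three_pos
  have t1 := finiteFibers_mul_triangular one_pos
  have t2 := finiteFibers_mul_triangular two_pos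
  have n1 : ∀ x : ℤ, 0 ≤ 1 * x ^ 2 := fun x => by positivity
  have n3 : ∀ x : ℤ, 0 ≤ 3 * x ^ 2 := fun x => by positivity
  have m1 : ∀ k : ℤ, 0 ≤ 1 * triangular k := fun k => by simpa using triangular_nonneg k
  have m2 : ∀ k : ℤ, 0 ≤ 2 * triangular k := fun k => by simpa using triangular_nonneg k
  rw [psiSum, psiSum, phiPlus, phiPlus, thetaSeries_mul h1 h1 n1 n1,
    thetaSeries_mul t1 (h1.add h1 n1 n1) m1 fun p => add_nonneg (n1 _) (n1 _),
    thetaSeries_mul t2 h3 m2 n3,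
    thetaSeries_mul t1 (t2.add h3 m2 n3) m1 fun p => add_nonneg (m2 _) (n3 _)]
  ext n
  rw [coeff_progression, coeff_thetaSeries, coeff_thetaSeries]
  have key := sum_ternarySolutions (16 * n + 6)
    (fun x y z => if Odd x ∧ (4 : ℤ) ∣ y ∧ (4 : ℤ) ∣ z then 1 else 0)
    (fun x y z => by simp) fun x y z => by simp [and_comm]
  rw [finsum_mem_indicator (finite_ternarySolutions two_pos one_pos one_pos _),
    finsum_mem_indicator (finite_ternarySolutions one_pos two_pos three_pos _)] at key
  convert key using 1
  · refine finsum_mem_eq_of_bijOn (fun v => (2 * v.1 + 1, 4 * v.2.1, 4 * v.2.2)) ⟨?_, ?_, ?_⟩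
      fun _ _ => by simp
    · rintro ⟨k, y, z⟩ h
      have := two_mul_triangular k
      simp only [ternarySolutions, Set.mem_ofPred_eq, Set.mem_inter_iff] at h ⊢
      push_cast at h
      exact ⟨by linarith, ⟨k, rfl⟩, ⟨y, rfl⟩, ⟨z, rfl⟩⟩
    · rintro ⟨k, y, z⟩ _ ⟨k', y', z'⟩ _ h
      simp only [Prod.mk.injEq] at h ⊢
      omega
    · rintro ⟨x, y, z⟩ ⟨h, hx, hy, hz⟩
      simp only [ternarySolutions, Set.mem_ofPred_eq] at h hx hy hz
      obtain ⟨k, rfl⟩ := hx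
      obtain ⟨y, rfl⟩ := hy
      obtain ⟨z, rfl⟩ := hz
      refine ⟨(k, y, z), ?_, rfl⟩
      have := two_mul_triangular k
      simp only [Set.mem_ofPred_eq]
      push_cast
      linarith
  -- On the parametrized line the weight requires s + t odd, 4 ∣ s - 2t and 4 ∣ 3w, that is t odd, s
  -- ≡ 2 mod 4 and 4 ∣ w.
  · refine finsum_mem_eq_of_bijOn (fun v => (2 * (2 * v.2.1 + 1), 2 * v.1 + 1, 4 * v.2.2))
      ⟨?_, ?_, ?_⟩ fun _ _ => by simp
    · rintro ⟨k, l, w⟩ h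
      have := two_mul_triangular k
      have := two_mul_triangular l
      simp only [ternarySolutions, Set.mem_ofPred_eq, Set.mem_inter_iff] at h ⊢
      refine ⟨by linarith, ⟨2 * l + 1 + k, by ring⟩, by omega, by omega⟩
    · rintro ⟨k, y, z⟩ _ ⟨k', y', z'⟩ _ h
      simp only [Prod.mk.injEq] at h ⊢
      omega
    · rintro ⟨s, t, w⟩ ⟨h, ⟨a, ha⟩, hb, hc⟩
      simp only [ternarySolutions, Set.mem_ofPred_eq] at h ha hb hc
      obtain ⟨w, rfl⟩ : (4 : ℤ) ∣ w := by omega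
      obtain ⟨k, rfl⟩ : ∃ k, t = 2 * k + 1 := ⟨(t - 1) / 2, by omega⟩
      obtain ⟨l, rfl⟩ : ∃ l, s = 2 * (2 * l + 1) := ⟨(s - 2) / 4, by omega⟩
      refine ⟨(k, l, w), ?_, rfl⟩
      have := two_mul_triangular k
      have := two_mul_triangular l
      simp only [Set.mem_ofPred_eq]
      linarith

lemma three_eq_zero_powerSeries : (3 : PowerSeries (ZMod 3)) = 0 := by
  have h : (3 : ZMod 3) = 0 := by decide
  rw [← map_ofNat (PowerSeries.C (R := ZMod 3)) 3]
  exact (congrArg _ h).trans (map_zero _)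

/-- Multiplied by φ(-q), the left side is φ(q)φ(-q²)φ(-q)³, and φ(q)φ(-q) = φ(-q²)² turns this into
φ(-q²)³φ(-q)². -/
lemma progression_poBarSeries : progression 0 poBarSeries = phiMinus 6 * phiMinus 1 := by
  have h := progression_mul_pow_three (r := 0) three_pos poBarSeries (phiMinus 1)
  rw [pow_succ, sq, mul_comm (phiMinus 1 * _), ← mul_assoc, poBarSeries_mul_phiMinus,
    progression_phiMinus, show (3 : ℤ) = 3 * 1 by norm_num, ← phiMinus_pow_three] at h
  have h6 := phiMinus_pow_three 2
  norm_num at h6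
  rw [← h6]
  apply mul_right_cancel₀ phiMinus_one_ne_zero
  linear_combination -h + (phiMinus 2 * phiMinus 1 ^ 2) * phiPlus_mul_phiMinus

lemma progression_pedSeries :
    progression 1 (PowerSeries.evalNegHom pedSeries) = psiSum 3 * phiPlus 1 := by
  have h := progression_mul_pow_three (r := 1) (by norm_num) (PowerSeries.evalNegHom pedSeries)
    (phiPlus 1)
  rw [pow_succ, sq, mul_comm (phiPlus 1 * _), ← mul_assoc, evalNegHom_pedSeries_mul_phiPlus,
    neg_mul] at h
  have hneg : ∀ f, progression 1 (-f) = -progression 1 f := fun f => by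
    ext n
    simp [coeff_progression]
  have h3 := phiPlus_pow_three 1
  have h3' := psiSum_pow_three 1
  norm_num at h3 h3'
  rw [hneg, progression_psiSum, ← h3] at h
  rw [← h3']
  apply mul_right_cancel₀ phiPlus_one_ne_zero
  linear_combination -h - (psiSum 1 * phiPlus 1 ^ 2) * psiSum_sq -
    (psiSum 1 * psiSum 2 * phiPlus 1 ^ 3) * three_eq_zero_powerSeries

/-! ### The congruences with representation numbers -/

lemma finsum_mem_const_eq {α : Type*} {s : Set α} (hs : s.Finite) (c : ZMod 3) :
    ∑ᶠ _i ∈ s, c = c * s.ncard := by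
  rw [finsum_mem_eq_finite_toFinset_sum _ hs, Finset.sum_const, Set.ncard_eq_toFinset_card _ hs,
    nsmul_eq_mul, mul_comm]

/-- The residue of x² + 6y² modulo 12 determines the parities of both x and y. -/
lemma paritySign_mul_eq_signF {x y : ℤ} {n : ℕ} (h : x ^ 2 + 6 * y ^ 2 = n) :
    paritySign y * paritySign x = (signF n : ZMod 3) := by
  have e : ((x % 12) ^ 2 + 6 * (y % 2) ^ 2) % 12 = ((n % 12 : ℕ) : ℤ) := by
    obtain ⟨a, ha⟩ : ∃ a, x = 12 * a + x % 12 := ⟨x / 12, by omega⟩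
    obtain ⟨b, hb⟩ : ∃ b, y = 2 * b + y % 2 := ⟨y / 2, by omega⟩
    generalize x % 12 = x' at *
    generalize y % 2 = y' at *
    subst ha hb
    have : (n : ℤ) = x' ^ 2 + 6 * y' ^ 2 +
        12 * (12 * a ^ 2 + 2 * a * x' + 2 * b ^ 2 + 2 * b * y') := by
      rw [← h]; ring
    push_cast
    rw [this, Int.add_mul_emod_self_left]
  have hx : Even x ↔ (x % 12) % 2 = 0 := by rw [Int.even_iff]; omega
  have hy : Even y ↔ y % 2 = 0 := Int.even_iff
  unfold paritySign signF
  simp only [hx, hy]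
  have h1 : 0 ≤ x % 12 := by omega
  have h2 : x % 12 < 12 := by omega
  have h3 : 0 ≤ y % 2 := by omega
  have h4 : y % 2 < 2 := by omega
  generalize x % 12 = x' at *
  generalize y % 2 = y' at *
  generalize n % 12 = m at *
  interval_cases x' <;> interval_cases y' <;> norm_num at e <;>
    (obtain rfl : m = _ := by exact_mod_cast e.symm) <;> decide

lemma poBar_three_mul (n : ℕ) :
    (poBar (3 * n) : ℤ) ≡ signF n * (numReps n (fun x y => x ^ 2 + 6 * y ^ 2) : ℤ) [ZMOD 3] := by
  refine (ZMod.intCast_eq_intCast_iff _ _ 3).1 ?_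
  push_cast
  have h1 := finiteFibers_mul_sq one_pos
  have h6 := finiteFibers_mul_sq (c := 6) (by norm_num)
  have n1 : ∀ x : ℤ, 0 ≤ 1 * x ^ 2 := fun x => by positivity
  have n6 : ∀ x : ℤ, 0 ≤ 6 * x ^ 2 := fun x => by positivity
  have h := congrArg (PowerSeries.coeff n) progression_poBarSeries
  rw [coeff_progression, add_zero, poBarSeries, PowerSeries.coeff_mk, phiMinus, phiMinus,
    thetaSeries_mul h6 h1 n6 n1, coeff_thetaSeries] at h
  rw [h, numReps]
  have hfin : {v : ℤ × ℤ | v.1 ^ 2 + 6 * v.2 ^ 2 = n}.Finite := by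
    refine ((h1.add h6 n1 n6) n).subset fun v hv => ?_
    simp only [Set.mem_ofPred_eq] at hv ⊢
    linarith
  rw [← finsum_mem_const_eq hfin]
  refine finsum_mem_eq_of_bijOn Prod.swap ⟨?_, Prod.swap_injective.injOn, ?_⟩ ?_
  · rintro ⟨y, x⟩ hv
    simp only [Set.mem_ofPred_eq, Prod.swap] at hv ⊢
    linarith
  · rintro ⟨x, y⟩ hv
    refine ⟨(y, x), ?_, rfl⟩
    simp only [Set.mem_ofPred_eq] at hv ⊢
    linarith
  · rintro ⟨y, x⟩ hv
    simp only [Set.mem_ofPred_eq] at hv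
    exact paritySign_mul_eq_signF (by linarith)

lemma ped_three_mul_add_one (n : ℕ) :
    (ped (3 * n + 1) : ℤ) ≡ (-1) ^ (n + 1) *
      (numReps (8 * n + 3) (fun x y => 2 * x ^ 2 + 3 * y ^ 2) : ℤ) [ZMOD 3] := by
  refine (ZMod.intCast_eq_intCast_iff _ _ 3).1 ?_
  push_cast
  have h1 := finiteFibers_mul_sq one_pos
  have t3 := finiteFibers_mul_triangular three_pos
  have n1 : ∀ x : ℤ, 0 ≤ 1 * x ^ 2 := fun x => by positivity
  have m3 : ∀ k : ℤ, 0 ≤ 3 * triangular k := fun k => by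
    have := triangular_nonneg k
    positivity
  have h := congrArg (PowerSeries.coeff n) progression_pedSeries
  rw [coeff_progression, pedSeries, PowerSeries.evalNegHom, PowerSeries.coeff_rescale,
    PowerSeries.coeff_mk, psiSum, phiPlus,
    thetaSeries_mul t3 h1 m3 n1, coeff_thetaSeries] at h
  have hfin : {v : ℤ × ℤ | 2 * v.1 ^ 2 + 3 * v.2 ^ 2 = ((8 * n + 3 : ℕ) : ℤ)}.Finite := by
    have h2 := finiteFibers_mul_sq two_pos
    have h3 := finiteFibers_mul_sq three_pos
    exact h2.add h3 (fun x => by positivity) (fun x => by positivity) _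
  have hR : (numReps (8 * n + 3) (fun x y => 2 * x ^ 2 + 3 * y ^ 2) : ZMod 3) =
      (-1) ^ (3 * n + 1) * (ped (3 * n + 1) : ZMod 3) := by
    rw [h, numReps, ← one_mul (Nat.cast _), ← finsum_mem_const_eq hfin]
    symm
    refine finsum_mem_eq_of_bijOn (fun v => (2 * v.2, 2 * v.1 + 1)) ⟨?_, ?_, ?_⟩ fun _ _ => by simp
    · rintro ⟨k, x⟩ hv
      have := two_mul_triangular k
      simp only [Set.mem_ofPred_eq] at hv ⊢
      push_cast
      linarith
    · rintro ⟨k, x⟩ _ ⟨k', x'⟩ _ h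
      simp only [Prod.mk.injEq] at h ⊢
      omega
    · rintro ⟨x, y⟩ hv
      simp only [Set.mem_ofPred_eq] at hv
      push_cast at hv
      obtain ⟨k, rfl⟩ : Odd y := by
        rw [← Int.not_even_iff_odd]
        rintro ⟨c, rfl⟩
        ring_nf at hv
        omega
      obtain ⟨c, rfl⟩ : Even x := by
        rw [← Int.not_odd_iff_even]
        rintro ⟨c, rfl⟩
        obtain ⟨d, hd⟩ := Int.even_mul_succ_self k
        have : 8 * c ^ 2 + 8 * c + 2 + 12 * (k * (k + 1)) = 8 * n := by linarith
        rw [hd] at this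
        ring_nf at this
        omega
      refine ⟨(k, c), ?_, ?_⟩
      · have := two_mul_triangular k
        simp only [Set.mem_ofPred_eq]
        linarith
      · simp only [Prod.mk.injEq, and_true]
        ring
  rw [hR, ← mul_assoc, ← pow_add, show n + 1 + (3 * n + 1) = 2 * (2 * n + 1) by ring, pow_mul]
  simp

lemma numReps_sixteen_mul (n : ℕ) :
    numReps (16 * n + 6) (fun x y => x ^ 2 + 6 * y ^ 2) =
      numReps (8 * n + 3) (fun x y => 2 * x ^ 2 + 3 * y ^ 2) := by
  unfold numReps
  symm
  refine Set.ncard_congr (fun v _ => (2 * v.1, v.2)) ?_ ?_ ?_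
  · rintro ⟨x, y⟩ h
    simp only [Set.mem_ofPred_eq] at h ⊢
    push_cast at h ⊢
    linarith
  · rintro ⟨x, y⟩ ⟨x', y'⟩ _ _ h
    simp only [Prod.mk.injEq] at h ⊢
    omega
  · rintro ⟨x, y⟩ h
    simp only [Set.mem_ofPred_eq] at h
    push_cast at h
    obtain ⟨c, rfl⟩ : Even x := by
      rw [← Int.even_pow' (n := 2) two_ne_zero]
      exact ⟨8 * n + 3 - 3 * y ^ 2, by linarith⟩
    refine ⟨(c, y), ?_, by simp only [Prod.mk.injEq, and_true]; ring⟩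
    simp only [Set.mem_ofPred_eq]
    push_cast
    linarith

lemma numReps_eq_zero_of_mod_three {n : ℕ} (hn : n % 3 = 2) :
    numReps (16 * n + 6) (fun x y => x ^ 2 + 6 * y ^ 2) = 0 := by
  have : {v : ℤ × ℤ | v.1 ^ 2 + 6 * v.2 ^ 2 = ((16 * n + 6 : ℕ) : ℤ)} = ∅ := by
    rw [Set.eq_empty_iff_forall_notMem]
    rintro ⟨x, y⟩ h
    simp only [Set.mem_ofPred_eq] at h
    push_cast at h
    have hx : x ^ 2 % 3 = ((x % 3) * (x % 3)) % 3 := by rw [sq, Int.mul_emod]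
    have : x % 3 = 0 ∨ x % 3 = 1 ∨ x % 3 = 2 := by omega
    rcases this with h' | h' | h' <;> rw [h'] at hx <;> omega
  rw [numReps, this, Set.ncard_empty]

lemma ped_three_mul_add_one_congr_poBar (n : ℕ) :
    (-1) ^ n * (ped (3 * n + 1) : ℤ) ≡ (poBar (48 * n + 18) : ℤ) [ZMOD 3] := by
  have h1 := (ped_three_mul_add_one n).mul_left ((-1) ^ n)
  have h2 := poBar_three_mul (16 * n + 6)
  rw [show 3 * (16 * n + 6) = 48 * n + 18 by ring] at h2
  refine h1.trans (Int.ModEq.symm (h2.trans ?_))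
  rw [← numReps_sixteen_mul, ← mul_assoc, ← pow_add, show n + (n + 1) = 2 * n + 1 by ring,
    pow_succ, pow_mul]
  -- If n ≡ 2 mod 3 the sign would be wrong, but then 16n + 6 ≡ 2 mod 3 is not represented and both
  -- sides vanish.
  by_cases hn : n % 3 = 2
  · rw [numReps_eq_zero_of_mod_three hn]
    simp
  · have : signF (16 * n + 6) = -1 := by
      rw [signF, if_pos (by omega)]
    rw [this]
    simp

/-! ### Representation numbers of the forms of discriminant -24 -/

/-- The number of representations of `n` by `A x² + B y²`. -/
noncomputable def diagReps (A B n : ℤ) : ℕ := {v : ℤ × ℤ | A * v.1 ^ 2 + B * v.2 ^ 2 = n}.ncard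

lemma finite_diagReps {A B : ℤ} (hA : 0 < A) (hB : 0 < B) (n : ℤ) :
    {v : ℤ × ℤ | A * v.1 ^ 2 + B * v.2 ^ 2 = n}.Finite :=
  (finiteFibers_mul_sq hA).add (finiteFibers_mul_sq hB) (fun x => by positivity)
    (fun x => by positivity) n

/-- Composition of forms: the substitution (αs - βt, δs + γt) has determinant p and carries Ax² +
By² to p(A's² + B't²). Its image is the sublattice p ∣ αy - δx, because αy - δx = pt. -/
lemma ncard_composition {A B A' B' α β γ δ p m : ℤ} (hp : Prime p)
    (h1 : A * α ^ 2 + B * δ ^ 2 = p * A') (h2 : A * β ^ 2 + B * γ ^ 2 = p * B')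
    (h3 : A * α * β = B * γ * δ) (h4 : α * γ + β * δ = p) (hα : ¬ p ∣ α) :
    ({v : ℤ × ℤ | A * v.1 ^ 2 + B * v.2 ^ 2 = p * m} ∩ {v | p ∣ α * v.2 - δ * v.1}).ncard =
      diagReps A' B' m := by
  symm
  refine Set.ncard_congr (fun v _ => (α * v.1 - β * v.2, δ * v.1 + γ * v.2)) ?_ ?_ ?_
  · rintro ⟨s, t⟩ h
    simp only [Set.mem_ofPred_eq, Set.mem_inter_iff] at h ⊢
    refine ⟨?_, t, ?_⟩
    · linear_combination s ^ 2 * h1 + t ^ 2 * h2 - 2 * s * t * h3 + p * h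
    · linear_combination t * h4
  · rintro ⟨s, t⟩ ⟨s', t'⟩ _ _ h
    simp only [Prod.mk.injEq] at h ⊢
    obtain ⟨e1, e2⟩ := h
    constructor
    · apply mul_left_cancel₀ hp.ne_zero
      rw [← h4]
      linear_combination γ * e1 + β * e2
    · apply mul_left_cancel₀ hp.ne_zero
      rw [← h4]
      linear_combination α * e2 - δ * e1
  · rintro ⟨x, y⟩ ⟨h, t, ht⟩
    simp only [Set.mem_ofPred_eq] at h ht
    obtain ⟨s, hs⟩ : p ∣ γ * x + β * y := by
      refine (hp.dvd_or_dvd (a := α) ⟨x + β * t, ?_⟩).resolve_left hα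
      linear_combination x * h4 + β * ht
    have ex : α * s - β * t = x := by
      apply mul_left_cancel₀ hp.ne_zero
      linear_combination x * h4 - α * hs + β * ht
    have ey : δ * s + γ * t = y := by
      apply mul_left_cancel₀ hp.ne_zero
      linear_combination y * h4 - δ * hs - γ * ht
    refine ⟨(s, t), ?_, by simp only [ex, ey]⟩
    simp only [Set.mem_ofPred_eq]
    apply mul_left_cancel₀ hp.ne_zero
    rw [← h, ← ex, ← ey]
    linear_combination -s ^ 2 * h1 - t ^ 2 * h2 + 2 * s * t * h3

lemma ncard_multiples {A B p m : ℤ} (hp : p ≠ 0) :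
    ({v : ℤ × ℤ | A * v.1 ^ 2 + B * v.2 ^ 2 = p * m} ∩ {v | p ∣ v.1 ∧ p ∣ v.2}).ncard =
      {v : ℤ × ℤ | p * (A * v.1 ^ 2 + B * v.2 ^ 2) = m}.ncard := by
  symm
  refine Set.ncard_congr (fun v _ => (p * v.1, p * v.2)) ?_ ?_ ?_
  · rintro ⟨s, t⟩ h
    simp only [Set.mem_ofPred_eq, Set.mem_inter_iff] at h ⊢
    exact ⟨by rw [← h]; ring, dvd_mul_right _ _, dvd_mul_right _ _⟩
  · rintro ⟨s, t⟩ ⟨s', t'⟩ _ _ h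
    simpa [hp] using h
  · rintro ⟨x, y⟩ ⟨h, ⟨s, hs⟩, t, ht⟩
    simp only [Set.mem_ofPred_eq] at h hs ht
    subst hs ht
    refine ⟨(s, t), ?_, rfl⟩
    simp only [Set.mem_ofPred_eq]
    apply mul_left_cancel₀ hp
    rw [← h]
    ring

/-- For a solution, p divides A(αy - δx)(αy + δx), so it lies in one of two conjugate sublattices,
each contributing the count for (A', B'). Their intersection consists of the multiples of p;
inclusion-exclusion gives the relation. -/
lemma diagReps_split {A B A' B' α β γ δ p m : ℤ} (hp : Prime p) (hA : 0 < A) (hB : 0 < B)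
    (h1 : A * α ^ 2 + B * δ ^ 2 = p * A') (h2 : A * β ^ 2 + B * γ ^ 2 = p * B')
    (h3 : A * α * β = B * γ * δ) (h4 : α * γ + β * δ = p) (hα : ¬ p ∣ α)
    (hpA : ¬ p ∣ A) (hp2 : ¬ p ∣ 2) :
    diagReps A B (p * m) + {v : ℤ × ℤ | p * (A * v.1 ^ 2 + B * v.2 ^ 2) = m}.ncard =
      2 * diagReps A' B' m := by
  have hfin := finite_diagReps hA hB (p * m)
  have hplus := ncard_composition (m := m) hp h1 h2 h3 h4 hα
  have hminus := ncard_composition (m := m) (β := -β) (δ := -δ) hp (by simpa using h1)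
    (by simpa using h2) (by linarith) (by linarith) hα
  have hunion := Set.ncard_union_add_ncard_inter
    ({v : ℤ × ℤ | A * v.1 ^ 2 + B * v.2 ^ 2 = p * m} ∩ {v | p ∣ α * v.2 - δ * v.1})
    ({v : ℤ × ℤ | A * v.1 ^ 2 + B * v.2 ^ 2 = p * m} ∩ {v | p ∣ α * v.2 - -δ * v.1})
    (hfin.inter_of_left _) (hfin.inter_of_left _)
  rw [hplus, hminus, ← two_mul, ← Set.inter_union_distrib_left, ← Set.inter_inter_distrib_left]
    at hunion
  rw [← hunion, ← ncard_multiples hp.ne_zero, diagReps]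
  congr 2
  · symm
    rw [Set.inter_eq_left]
    rintro ⟨x, y⟩ h
    simp only [Set.mem_ofPred_eq, Set.mem_union] at h ⊢
    apply hp.dvd_or_dvd
    refine (hp.dvd_or_dvd (a := A) ⟨A' * y ^ 2 - δ ^ 2 * m, ?_⟩).resolve_left hpA
    linear_combination y ^ 2 * h1 - δ ^ 2 * h
  · ext ⟨x, y⟩
    simp only [Set.mem_inter_iff, Set.mem_ofPred_eq, and_congr_right_iff]
    intro h
    constructor
    · rintro ⟨hx, hy⟩
      exact ⟨dvd_sub (hy.mul_left _) (hx.mul_left _), dvd_sub (hy.mul_left _) (hx.mul_left _)⟩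
    · rintro ⟨ha, hb⟩
      have hy : p ∣ y := by
        have h2y : p ∣ 2 * (α * y) := by
          have := dvd_add ha hb
          rwa [show α * y - δ * x + (α * y - -δ * x) = 2 * (α * y) by ring] at this
        exact ((hp.dvd_or_dvd ((hp.dvd_or_dvd h2y).resolve_left hp2)).resolve_left hα)
      refine ⟨?_, hy⟩
      obtain ⟨z, rfl⟩ := hy
      exact hp.dvd_of_dvd_pow ((hp.dvd_or_dvd (a := A) (b := x ^ 2) ⟨m - B * p * z ^ 2, by
        linear_combination h⟩).resolve_left hpA)

lemma diagReps_inert {A B m : ℤ} {p : ℕ} [Fact p.Prime] (hAB : A * B = 6)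
    (hpA : ¬ (p : ℤ) ∣ A) (hns : ¬ IsSquare (-6 : ZMod p)) :
    diagReps A B (p * m) = {v : ℤ × ℤ | p * (A * v.1 ^ 2 + B * v.2 ^ 2) = m}.ncard := by
  have hp : Prime (p : ℤ) := Nat.prime_iff_prime_int.1 Fact.out
  rw [← ncard_multiples hp.ne_zero, diagReps]
  congr 1
  symm
  rw [Set.inter_eq_left]
  rintro ⟨x, y⟩ h
  simp only [Set.mem_ofPred_eq] at h ⊢
  have hy : (p : ℤ) ∣ y := by
    by_contra hy
    rw [← ZMod.intCast_zmod_eq_zero_iff_dvd] at hy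
    -- If p does not divide y, then (Ax)² = -AB y² = -6y² modulo p.
    refine hns ⟨A * x / y, ?_⟩
    have h' := congrArg (Int.cast : ℤ → ZMod p) h
    have hAB' := congrArg (Int.cast : ℤ → ZMod p) hAB
    push_cast at h' hAB'
    rw [ZMod.natCast_self, zero_mul] at h'
    field_simp
    linear_combination (-(A : ZMod p)) * h' + (y : ZMod p) ^ 2 * hAB'
  refine ⟨?_, hy⟩
  obtain ⟨z, rfl⟩ := hy
  exact hp.dvd_of_dvd_pow ((hp.dvd_or_dvd (a := A) (b := x ^ 2) ⟨m - B * p * z ^ 2, by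
    linear_combination h⟩).resolve_left hpA)

/-- Every positive form `a X² + 2 b X Y + c Y²` with `a c - b² = 6` is equivalent to
`X² + 6 Y²` or `2 X² + 3 Y²`. -/
lemma exists_reduced_form (N : ℕ) : ∀ a b c : ℤ, 0 < a → a * c - b ^ 2 = 6 → b.natAbs ≤ N →
    ∃ A B α β γ δ : ℤ, (A = 1 ∧ B = 6 ∨ A = 2 ∧ B = 3) ∧ a = A * α ^ 2 + B * γ ^ 2 ∧
      b = A * α * β + B * γ * δ ∧ c = A * β ^ 2 + B * δ ^ 2 := by
  induction N with
  | zero =>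
    intro a b c ha h hb
    obtain rfl : b = 0 := by omega
    have h6 : a * c = 6 := by linarith
    have hc : 0 < c := by
      by_contra hc
      nlinarith
    have ha6 : a ≤ 6 := by nlinarith
    interval_cases a
    · exact ⟨1, 6, 1, 0, 0, 1, by simp, by simp, by simp, by omega⟩
    · exact ⟨2, 3, 1, 0, 0, 1, by simp, by simp, by simp, by omega⟩
    · exact ⟨2, 3, 0, 1, 1, 0, by simp, by simp, by simp, by omega⟩
    · omega
    · omega
    · exact ⟨1, 6, 0, 1, 1, 0, by simp, by simp, by simp, by omega⟩
  | succ N ih =>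
    intro a b c ha h hb
    have hc : 0 < c := by
      by_contra hc
      nlinarith [sq_nonneg b]
    -- Gauss reduction: as long as 2|b| exceeds a or c, a unit shear makes |b| smaller. Otherwise
    -- 4b² ≤ ac = b² + 6, so |b| ≤ 1; the case |b| = 1 would need ac = 7 with a, c ≥ 2.
    by_cases h1 : a < 2 * |b|
    · rcases le_or_gt 0 b with hb0 | hb0
      · rw [abs_of_nonneg hb0] at h1
        obtain ⟨A, B, α, β, γ, δ, hAB, e1, e2, e3⟩ := ih a (b - a) (c - 2 * b + a) ha
          (by linarith) (by omega)
        refine ⟨A, B, α, β + α, γ, δ + γ, hAB, e1, ?_, ?_⟩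
        · linear_combination e1 + e2
        · linear_combination e1 + 2 * e2 + e3
      · rw [abs_of_neg hb0] at h1
        obtain ⟨A, B, α, β, γ, δ, hAB, e1, e2, e3⟩ := ih a (b + a) (c + 2 * b + a) ha
          (by linarith) (by omega)
        refine ⟨A, B, α, β - α, γ, δ - γ, hAB, e1, ?_, ?_⟩
        · linear_combination e2 - e1
        · linear_combination e1 - 2 * e2 + e3
    by_cases h2 : c < 2 * |b|
    · rcases le_or_gt 0 b with hb0 | hb0
      · rw [abs_of_nonneg hb0] at h2
        obtain ⟨A, B, α, β, γ, δ, hAB, e1, e2, e3⟩ := ih c (b - c) (a - 2 * b + c) hc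
          (by linarith) (by omega)
        refine ⟨A, B, β + α, α, δ + γ, γ, hAB, ?_, ?_, e1⟩
        · linear_combination e1 + 2 * e2 + e3
        · linear_combination e1 + e2
      · rw [abs_of_neg hb0] at h2
        obtain ⟨A, B, α, β, γ, δ, hAB, e1, e2, e3⟩ := ih c (b + c) (a + 2 * b + c) hc
          (by linarith) (by omega)
        refine ⟨A, B, β - α, α, δ - γ, γ, hAB, ?_, ?_, e1⟩
        · linear_combination e1 - 2 * e2 + e3
        · linear_combination e2 - e1
    push Not at h1 h2
    have hb1 : |b| ≤ 1 := by
      have hsq := sq_abs b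
      have h0 := abs_nonneg b
      by_contra hh
      have : 4 * |b| ^ 2 ≤ a * c := by nlinarith
      nlinarith
    rcases (abs_nonneg b).eq_or_lt with h0 | h0
    · exact ih a b c ha h (by simp [abs_eq_zero.1 h0.symm])
    · have hb2 : b ^ 2 = 1 := by
        rw [← sq_abs, show |b| = 1 by omega]
        norm_num
      have : a * c = 7 := by linarith
      have ha7 : a ≤ 3 := by nlinarith
      interval_cases a <;> omega

lemma exists_rep_of_isSquare {p : ℕ} [Fact p.Prime] (h : IsSquare (-6 : ZMod p)) :
    ∃ A B a b : ℤ, (A = 1 ∧ B = 6 ∨ A = 2 ∧ B = 3) ∧ (p : ℤ) = A * a ^ 2 + B * b ^ 2 := by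
  obtain ⟨u, hu⟩ := h
  obtain ⟨h, rfl⟩ := ZMod.intCast_surjective u
  have hdvd : (p : ℤ) ∣ h ^ 2 + 6 := by
    rw [← ZMod.intCast_zmod_eq_zero_iff_dvd]
    push_cast
    linear_combination -hu
  obtain ⟨c, hc⟩ := hdvd
  have hp : 0 < (p : ℤ) := by exact_mod_cast (Fact.out : p.Prime).pos
  obtain ⟨A, B, α, β, γ, δ, hAB, e, -⟩ := exists_reduced_form _ p h c hp (by linarith) le_rfl
  exact ⟨A, B, α, γ, hAB, e⟩

/-- The Jacobi symbol of -6 has period 4 · 6 = 24 in its odd lower argument. -/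
lemma legendreSym_neg_six {p : ℕ} [Fact p.Prime] (hp : Odd p) :
    legendreSym p (-6) = jacobiSym (-6) (p % 24) := by
  rw [jacobiSym.legendreSym.to_jacobiSym, jacobiSym.mod_right _ hp]
  rfl

lemma isSquare_neg_six {p : ℕ} [Fact p.Prime]
    (h : p % 24 = 1 ∨ p % 24 = 5 ∨ p % 24 = 7 ∨ p % 24 = 11) : IsSquare (-6 : ZMod p) := by
  have hl : legendreSym p (-6) = 1 := by
    rw [legendreSym_neg_six (by rw [Nat.odd_iff]; omega)]
    rcases h with h | h | h | h <;> rw [h] <;> norm_num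
  have h0 : ((-6 : ℤ) : ZMod p) ≠ 0 := by
    intro h0
    rw [(legendreSym.eq_zero_iff p (-6)).2 h0] at hl
    omega
  simpa using (legendreSym.eq_one_iff p h0).1 hl

lemma not_isSquare_neg_six {p : ℕ} [Fact p.Prime]
    (h : p % 24 = 13 ∨ p % 24 = 17 ∨ p % 24 = 19 ∨ p % 24 = 23) : ¬ IsSquare (-6 : ZMod p) := by
  have hl : legendreSym p (-6) = -1 := by
    rw [legendreSym_neg_six (by rw [Nat.odd_iff]; omega)]
    rcases h with h | h | h | h <;> rw [h] <;> norm_num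
  simpa using (legendreSym.eq_neg_one_iff p).1 hl

/-! ### The genus formula -/

/-- The leading coefficient of the reduced form in the class `c`. -/
def formA (c : ZMod 2) : ℤ := if c = 0 then 1 else 2

/-- The last coefficient of the reduced form in the class `c`. -/
def formB (c : ZMod 2) : ℤ := if c = 0 then 6 else 3

/-- The number of representations of `n` by the reduced form in the class `c`. -/
noncomputable def classReps (c : ZMod 2) (n : ℕ) : ℤ := (diagReps (formA c) (formB c) n : ℤ)

/-- The class of the prime ideals above the non-inert prime `p`. -/
def primeClass (p : ℕ) : ZMod 2 :=
  if p = 2 ∨ p = 3 ∨ p % 24 = 5 ∨ p % 24 = 11 then 1 else 0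

/-- The local factor at `p` of the total number of representations. -/
def localFactor (p k : ℕ) : ℤ :=
  (if p % 24 = 1 ∨ p % 24 = 5 ∨ p % 24 = 7 ∨ p % 24 = 11 then 1 + (k : ℤ) else 1) *
    (if p % 24 = 13 ∨ p % 24 = 17 ∨ p % 24 = 19 ∨ p % 24 = 23 then (1 + (-1) ^ k) / 2 else 1)

lemma zmod_two_cases (c : ZMod 2) : c = 0 ∨ c = 1 := by
  revert c
  decide

lemma classReps_two_mul (c : ZMod 2) (n : ℕ) : classReps c (2 * n) = classReps (c + 1) n := by
  unfold classReps diagReps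
  norm_cast
  symm
  rcases zmod_two_cases c with rfl | rfl
  · refine Set.ncard_congr (fun v _ => (2 * v.1, v.2)) ?_ ?_ ?_
    · rintro ⟨s, t⟩ h
      simp [formA, formB] at h ⊢
      linarith
    · rintro ⟨s, t⟩ ⟨s', t'⟩ _ _ h
      simpa using h
    · rintro ⟨x, y⟩ h
      simp [formA, formB] at h
      obtain ⟨s, rfl⟩ : (2 : ℤ) ∣ x :=
        Int.prime_two.dvd_of_dvd_pow (n := 2) ⟨n - 3 * y ^ 2, by linarith⟩
      refine ⟨(s, y), ?_, rfl⟩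
      simp [formA, formB]
      linarith
  · rw [show (1 + 1 : ZMod 2) = 0 by decide]
    refine Set.ncard_congr (fun v _ => (v.1, 2 * v.2)) ?_ ?_ ?_
    · rintro ⟨s, t⟩ h
      simp [formA, formB] at h ⊢
      linarith
    · rintro ⟨s, t⟩ ⟨s', t'⟩ _ _ h
      simpa using h
    · rintro ⟨x, y⟩ h
      simp [formA, formB] at h
      obtain ⟨t, rfl⟩ : (2 : ℤ) ∣ y :=
        Int.prime_two.dvd_of_dvd_pow (n := 2) ⟨n - x ^ 2 - y ^ 2, by linarith⟩
      refine ⟨(x, t), ?_, rfl⟩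
      simp [formA, formB]
      linarith

lemma classReps_three_mul (c : ZMod 2) (n : ℕ) : classReps c (3 * n) = classReps (c + 1) n := by
  unfold classReps diagReps
  norm_cast
  symm
  have inj : ∀ a b : ℤ × ℤ, (3 * a.2, a.1) = (3 * b.2, b.1) → a = b := by
    rintro ⟨s, t⟩ ⟨s', t'⟩ h
    simp only [Prod.mk.injEq] at h ⊢
    omega
  rcases zmod_two_cases c with rfl | rfl
  · refine Set.ncard_congr (fun v _ => (3 * v.2, v.1)) ?_ (fun a b _ _ => inj a b) ?_
    · rintro ⟨s, t⟩ h
      simp [formA, formB] at h ⊢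
      linarith
    · rintro ⟨x, y⟩ h
      simp [formA, formB] at h
      obtain ⟨t, rfl⟩ : (3 : ℤ) ∣ x :=
        Int.prime_three.dvd_of_dvd_pow (n := 2) ⟨n - 2 * y ^ 2, by linarith⟩
      refine ⟨(y, t), ?_, rfl⟩
      simp [formA, formB]
      linarith
  · rw [show (1 + 1 : ZMod 2) = 0 by decide]
    refine Set.ncard_congr (fun v _ => (3 * v.2, v.1)) ?_ (fun a b _ _ => inj a b) ?_
    · rintro ⟨s, t⟩ h
      simp [formA, formB] at h ⊢
      linarith
    · rintro ⟨x, y⟩ h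
      simp [formA, formB] at h
      obtain ⟨t, rfl⟩ : (3 : ℤ) ∣ x :=
        Int.prime_three.dvd_of_dvd_pow (n := 2) ⟨x ^ 2 + y ^ 2 - n, by linarith⟩
      refine ⟨(y, t), ?_, rfl⟩
      simp [formA, formB]
      linarith

lemma formA_pos (c : ZMod 2) : 0 < formA c := by
  unfold formA
  split_ifs <;> norm_num

lemma formB_pos (c : ZMod 2) : 0 < formB c := by
  unfold formB
  split_ifs <;> norm_num

lemma formA_mul_formB (c : ZMod 2) : formA c * formB c = 6 := by
  unfold formA formB
  split_ifs <;> norm_num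

lemma not_dvd_of_five_le {p : ℕ} (hp : 5 ≤ p) {a : ℤ} (h0 : 0 < a) (h : a < 5) :
    ¬ (p : ℤ) ∣ a := fun hd => by
  have := Int.le_of_dvd h0 hd
  omega

lemma formA_lt (c : ZMod 2) : formA c < 5 := by
  unfold formA
  split_ifs <;> norm_num

lemma ncard_scaled_of_mul {A B : ℤ} {p : ℕ} (hp : p ≠ 0) (n : ℕ) :
    {v : ℤ × ℤ | (p : ℤ) * (A * v.1 ^ 2 + B * v.2 ^ 2) = ((p * n : ℕ) : ℤ)}.ncard =
      diagReps A B n := by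
  unfold diagReps
  congr 1
  ext v
  simp [hp]

lemma ncard_scaled_of_not_dvd {A B : ℤ} {p n : ℕ} (h : ¬ p ∣ n) :
    {v : ℤ × ℤ | (p : ℤ) * (A * v.1 ^ 2 + B * v.2 ^ 2) = (n : ℤ)}.ncard = 0 := by
  have : {v : ℤ × ℤ | (p : ℤ) * (A * v.1 ^ 2 + B * v.2 ^ 2) = (n : ℤ)} = ∅ := by
    rw [Set.eq_empty_iff_forall_notMem]
    intro v hv
    exact h (Int.natCast_dvd_natCast.1 ⟨_, hv.symm⟩)
  rw [this, Set.ncard_empty]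

lemma classReps_inert {p : ℕ} [Fact p.Prime]
    (h : p % 24 = 13 ∨ p % 24 = 17 ∨ p % 24 = 19 ∨ p % 24 = 23) (c : ZMod 2) (n : ℕ) :
    classReps c (p * n) =
      ({v : ℤ × ℤ | (p : ℤ) * (formA c * v.1 ^ 2 + formB c * v.2 ^ 2) = n}.ncard : ℤ) := by
  rw [classReps, Nat.cast_mul, diagReps_inert (formA_mul_formB c)
    (not_dvd_of_five_le (by omega) (formA_pos c) (formA_lt c)) (not_isSquare_neg_six h)]

/-- Reduction gives one of the two forms, and p modulo 3 tells which: x² + 6y² yields 1 and 2x² +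
3y² yields 2. -/
lemma exists_primeClass_rep {p : ℕ} [Fact p.Prime]
    (h : p % 24 = 1 ∨ p % 24 = 5 ∨ p % 24 = 7 ∨ p % 24 = 11) :
    ∃ a b : ℤ, (p : ℤ) = formA (primeClass p) * a ^ 2 + formB (primeClass p) * b ^ 2 := by
  obtain ⟨A, B, a, b, hAB, e⟩ := exists_rep_of_isSquare (isSquare_neg_six h)
  have ha : a ^ 2 % 3 = ((a % 3) * (a % 3)) % 3 := by rw [sq, Int.mul_emod]
  have ha3 : a % 3 = 0 ∨ a % 3 = 1 ∨ a % 3 = 2 := by omega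
  refine ⟨a, b, ?_⟩
  rcases hAB with ⟨rfl, rfl⟩ | ⟨rfl, rfl⟩
  · have hp : primeClass p = 0 := by
      rw [primeClass, if_neg]
      rcases ha3 with h' | h' | h' <;> rw [h'] at ha <;> omega
    rw [hp, e]
    simp [formA, formB]
  · have hp : primeClass p = 1 := by
      rw [primeClass, if_pos]
      rcases ha3 with h' | h' | h' <;> rw [h'] at ha <;> omega
    rw [hp, e]
    simp [formA, formB]

lemma classReps_split {p : ℕ} [Fact p.Prime]
    (h : p % 24 = 1 ∨ p % 24 = 5 ∨ p % 24 = 7 ∨ p % 24 = 11) (c : ZMod 2) (n : ℕ) :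
    classReps c (p * n) +
        ({v : ℤ × ℤ | (p : ℤ) * (formA c * v.1 ^ 2 + formB c * v.2 ^ 2) = n}.ncard : ℤ) =
      2 * classReps (c + primeClass p) n := by
  have hprime : p.Prime := Fact.out
  have hp : Prime (p : ℤ) := Nat.prime_iff_prime_int.1 hprime
  have hp5 : 5 ≤ p := by
    have := hprime.two_le
    omega
  have hp2 := not_dvd_of_five_le hp5 (a := 2) (by norm_num) (by norm_num)
  have hp3 := not_dvd_of_five_le hp5 (a := 3) (by norm_num) (by norm_num)
  have hpA := not_dvd_of_five_le hp5 (formA_pos c) (formA_lt c)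
  obtain ⟨a, b, e⟩ := exists_primeClass_rep h
  have ha : ¬ (p : ℤ) ∣ a := by
    rintro ⟨x, rfl⟩
    have hB : ¬ (p : ℤ) ∣ formB (primeClass p) := by
      intro hd
      have h6 : (p : ℤ) ∣ 2 * 3 := by
        have := hd.mul_left (formA (primeClass p))
        rwa [formA_mul_formB] at this
      exact (hp.dvd_or_dvd h6).elim hp2 hp3
    obtain ⟨y, rfl⟩ : (p : ℤ) ∣ b := hp.dvd_of_dvd_pow ((hp.dvd_or_dvd
      (b := b ^ 2) ⟨1 - formA (primeClass p) * p * x ^ 2, by linear_combination -e⟩).resolve_left hB)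
    refine hp.not_isUnit (isUnit_of_dvd_one (?_ : (p : ℤ) ∣ 1))
    refine ⟨formA (primeClass p) * x ^ 2 + formB (primeClass p) * y ^ 2, ?_⟩
    apply mul_left_cancel₀ hp.ne_zero
    linear_combination e
  have h2a : ¬ (p : ℤ) ∣ 2 * a := fun hd => (hp.dvd_or_dvd hd).elim hp2 ha
  -- The coefficients below come from composing the form of class c with the representation (a, b)
  -- of p, one case for each pair of classes.
  have hsplit := fun α β γ δ : ℤ => diagReps_split (A := formA c) (B := formB c)
    (A' := formA (c + primeClass p)) (B' := formB (c + primeClass p)) (α := α) (β := β)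
    (γ := γ) (δ := δ) (m := n) hp
  simp only [classReps, Nat.cast_mul]
  norm_cast
  generalize primeClass p = d at *
  rcases zmod_two_cases c with rfl | rfl <;> rcases zmod_two_cases d with rfl | rfl
  · refine hsplit a (6 * b) a b (formA_pos _) (formB_pos _) ?_ ?_ ?_ ?_ ha hpA hp2 <;>
      simp [formA, formB] at e ⊢ <;> (try rw [e]) <;> ring
  · refine hsplit (2 * a) (3 * b) a b (formA_pos _) (formB_pos _) ?_ ?_ ?_ ?_ h2a hpA hp2 <;>
      simp [formA, formB] at e ⊢ <;> (try rw [e]) <;> ring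
  · refine hsplit a (3 * b) a (2 * b) (formA_pos _) (formB_pos _) ?_ ?_ ?_ ?_ ha hpA hp2 <;>
      simp [formA, formB] at e ⊢ <;> (try rw [e]) <;> ring
  · rw [show (1 + 1 : ZMod 2) = 0 by decide] at *
    refine hsplit a (3 * b) (2 * a) b (formA_pos _) (formB_pos _) ?_ ?_ ?_ ?_ ha hpA hp2 <;>
      simp [formA, formB] at e ⊢ <;> (try rw [e]) <;> ring

lemma prime_mod_cases {p : ℕ} (hp : p.Prime) : p = 2 ∨ p = 3 ∨
    (p % 24 = 1 ∨ p % 24 = 5 ∨ p % 24 = 7 ∨ p % 24 = 11) ∨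
    (p % 24 = 13 ∨ p % 24 = 17 ∨ p % 24 = 19 ∨ p % 24 = 23) := by
  by_cases h2 : p = 2
  · exact Or.inl h2
  by_cases h3 : p = 3
  · exact Or.inr (Or.inl h3)
  have e2 : ¬ 2 ∣ p := fun h => h2 ((Nat.prime_dvd_prime_iff_eq Nat.prime_two hp).1 h).symm
  have e3 : ¬ 3 ∣ p := fun h => h3 ((Nat.prime_dvd_prime_iff_eq Nat.prime_three hp).1 h).symm
  omega

lemma classReps_ramified {p m : ℕ} (h1 : ∀ c n, classReps c (p * n) = classReps (c + 1) n)
    (h2 : primeClass p = 1) (h3 : ∀ k, localFactor p k = 1) (k : ℕ) :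
    ∀ c, classReps c (p ^ k * m) = localFactor p k * classReps (c + k * primeClass p) m := by
  rw [h3, h2]
  induction k with
  | zero => simp
  | succ k ih =>
    intro c
    rw [pow_succ', mul_assoc, h1, ih]
    push_cast
    ring_nf

lemma zmod_two_add_succ_mul (c d x : ZMod 2) : c + d + (x + 1) * d = c + x * d := by
  revert c d x
  decide

lemma zmod_two_add_two_mul (c d x : ZMod 2) : c + (x + 2) * d = c + x * d := by
  revert c d x
  decide

lemma classReps_prime_pow_mul {p m : ℕ} (hp : p.Prime) (hm : ¬ p ∣ m) (k : ℕ) :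
    ∀ c, classReps c (p ^ k * m) = localFactor p k * classReps (c + k * primeClass p) m := by
  have : Fact p.Prime := ⟨hp⟩
  rcases prime_mod_cases hp with rfl | rfl | h | h
  · exact classReps_ramified classReps_two_mul (by simp [primeClass]) (fun k => by simp [localFactor]) k
  · exact classReps_ramified classReps_three_mul (by simp [primeClass]) (fun k => by simp [localFactor]) k
  · have hloc : ∀ k, localFactor p k = 1 + (k : ℤ) := fun k => by
      rw [localFactor, if_pos h, if_neg (by omega), mul_one]
    simp only [hloc]
    induction k using Nat.twoStepInduction with
    | zero => simp
    | one =>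
      intro c
      have := classReps_split h c m
      rw [ncard_scaled_of_not_dvd hm] at this
      simp only [pow_one, Nat.cast_one, one_mul, Nat.cast_zero, add_zero] at this ⊢
      linarith
    -- The two terms carry the same class, since the group has exponent 2, and 2(k + 2) - (k + 1) =
    -- k + 3.
    | more k ih1 ih2 =>
      intro c
      have := classReps_split h c (p * (p ^ k * m))
      rw [ncard_scaled_of_mul hp.ne_zero, ← classReps, ih1, ← mul_assoc p (p ^ k), ← pow_succ',
        ih2] at this
      have e1 : c + primeClass p + ((k + 1 : ℕ) : ZMod 2) * primeClass p =
          c + ((k : ℕ) : ZMod 2) * primeClass p := by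
        push_cast
        exact zmod_two_add_succ_mul _ _ _
      have e2 : c + ((k + 2 : ℕ) : ZMod 2) * primeClass p =
          c + ((k : ℕ) : ZMod 2) * primeClass p := by
        push_cast
        exact zmod_two_add_two_mul _ _ _
      rw [e1] at this
      rw [e2, pow_succ', mul_assoc]
      push_cast at this ⊢
      linarith
  · have hcls : primeClass p = 0 := by
      have := hp.two_le
      rw [primeClass, if_neg (by omega)]
    have hloc : ∀ k, localFactor p k = (1 + (-1) ^ k) / 2 := fun k => by
      rw [localFactor, if_neg (by omega), if_pos h, one_mul]
    simp only [hloc, hcls, mul_zero, add_zero]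
    induction k using Nat.twoStepInduction with
    | zero => simp
    | one =>
      intro c
      rw [pow_one, classReps_inert h, ncard_scaled_of_not_dvd hm]
      simp
    | more k ih1 _ =>
      intro c
      rw [pow_succ', pow_succ', mul_assoc, mul_assoc, classReps_inert h,
        ncard_scaled_of_mul hp.ne_zero, ← classReps, ih1]
      ring_nf

lemma classReps_one (c : ZMod 2) : classReps c 1 = if c = 0 then 2 else 0 := by
  rcases zmod_two_cases c with rfl | rfl
  · have : {v : ℤ × ℤ | formA 0 * v.1 ^ 2 + formB 0 * v.2 ^ 2 = ((1 : ℕ) : ℤ)} =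
        {(1, 0), (-1, 0)} := by
      ext ⟨x, y⟩
      simp only [formA, formB, Set.mem_ofPred_eq, Set.mem_insert_iff, Set.mem_singleton_iff,
        Prod.mk.injEq, if_true]
      constructor
      · intro h
        push_cast at h
        have hy : y = 0 := by
          by_contra hy
          have : 0 < y ^ 2 := by positivity
          nlinarith [sq_nonneg x]
        subst hy
        have hx : (x - 1) * (x + 1) = 0 := by linarith
        rcases mul_eq_zero.1 hx with hx | hx
        · exact Or.inl ⟨by omega, rfl⟩
        · exact Or.inr ⟨by omega, rfl⟩
      · rintro (⟨rfl, rfl⟩ | ⟨rfl, rfl⟩) <;> norm_num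
    rw [classReps, diagReps, this, Set.ncard_pair (by simp)]
    simp
  · have : {v : ℤ × ℤ | formA 1 * v.1 ^ 2 + formB 1 * v.2 ^ 2 = ((1 : ℕ) : ℤ)} = ∅ := by
      rw [Set.eq_empty_iff_forall_notMem]
      rintro ⟨x, y⟩ h
      simp [formA, formB] at h
      have hx := sq_nonneg x
      have hy := sq_nonneg y
      omega
    rw [classReps, diagReps, this, Set.ncard_empty]
    simp

/-- The class of the product of the prime ideals dividing `n`. -/
def classOf (n : ℕ) : ZMod 2 := n.factorization.sum fun p k => k * primeClass p

/-- The number of ideals of norm `n` in the maximal order. -/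
def idealCount (n : ℕ) : ℤ := n.factorization.prod localFactor

lemma localFactor_zero (p : ℕ) : localFactor p 0 = 1 := by
  simp [localFactor]

/-- Stripping off prime powers shifts the class and multiplies by local factors until n = 1, which
only the form of class 0 represents, by (±1, 0). -/
lemma classReps_eq (n : ℕ) : n ≠ 0 → ∀ c,
    classReps c n = (if c + classOf n = 0 then 2 else 0) * idealCount n := by
  induction n using Nat.recOnPrimePow with
  | zero => intro h; exact absurd rfl h
  | one =>
    intro _ c
    rw [classReps_one]
    simp [classOf, idealCount]
  | prime_pow_mul m p k hp hm hk ih =>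
    intro _ c
    have hm0 : m ≠ 0 := by
      rintro rfl
      exact hm (dvd_zero p)
    have hcop : Nat.Coprime (p ^ k) m := Nat.Coprime.pow_left k ((hp.coprime_iff_not_dvd).2 hm)
    have hdis := hcop.disjoint_primeFactors
    have hcls : classOf (p ^ k * m) = k * primeClass p + classOf m := by
      rw [classOf, Nat.factorization_mul_of_coprime hcop, Finsupp.sum_add_index_of_disjoint hdis,
        hp.factorization_pow, Finsupp.sum_single_index (by simp), classOf]
    have hcnt : idealCount (p ^ k * m) = localFactor p k * idealCount m := by
      rw [idealCount, Nat.factorization_mul_of_coprime hcop,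
        Finsupp.prod_add_index_of_disjoint hdis, hp.factorization_pow,
        Finsupp.prod_single_index (localFactor_zero p), idealCount]
    rw [classReps_prime_pow_mul hp hm, ih hm0, hcls, hcnt, add_assoc]
    ring

lemma idealCount_eq (n : ℕ) : idealCount n =
    (∏ p ∈ pPrimes n, (1 + (n.factorization p : ℤ))) *
      ∏ q ∈ qPrimes n, ((1 + (-1) ^ (n.factorization q)) / 2 : ℤ) := by
  rw [idealCount, Finsupp.prod, Nat.support_factorization, pPrimes, qPrimes, Finset.prod_filter,
    Finset.prod_filter, ← Finset.prod_mul_distrib]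
  rfl

lemma classOf_eq (n : ℕ) :
    classOf n = ((n.factorization 2 + n.factorization 3 + tCount n : ℕ) : ZMod 2) := by
  have hsingle : ∀ r : ℕ, n.factorization r =
      ∑ p ∈ n.primeFactors, if p = r then n.factorization p else 0 := by
    intro r
    rw [Finset.sum_ite_eq']
    split_ifs with h
    · rfl
    · rwa [← Nat.support_factorization, Finsupp.notMem_support_iff] at h
  rw [classOf, Finsupp.sum, Nat.support_factorization, tCount, Finset.sum_filter, hsingle 2,
    hsingle 3, ← Finset.sum_add_distrib, ← Finset.sum_add_distrib, Nat.cast_sum]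
  refine Finset.sum_congr rfl fun p _ => ?_
  by_cases h2 : p = 2
  · simp [h2, primeClass]
  by_cases h3 : p = 3
  · simp [h3, primeClass]
  by_cases h5 : p % 24 = 5 ∨ p % 24 = 11
  · simp [h2, h3, h5, primeClass]
  · simp [h2, h3, h5, primeClass]

lemma numReps_one_six {n : ℕ} (hn : 1 ≤ n) :
    (numReps n (fun x y => x ^ 2 + 6 * y ^ 2) : ℤ) =
      (1 + (-1) ^ (n.factorization 2 + n.factorization 3 + tCount n)) *
        (∏ p ∈ pPrimes n, (1 + (n.factorization p : ℤ))) *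
        (∏ q ∈ qPrimes n, ((1 + (-1) ^ (n.factorization q)) / 2 : ℤ)) := by
  have h := classReps_eq n (by omega) 0
  rw [idealCount_eq, classOf_eq, zero_add, ← mul_assoc] at h
  have hR : (numReps n (fun x y => x ^ 2 + 6 * y ^ 2) : ℤ) = classReps 0 n := by
    simp [numReps, classReps, diagReps, formA, formB]
  rw [hR, h]
  congr 2
  rcases Nat.even_or_odd (n.factorization 2 + n.factorization 3 + tCount n) with he | ho
  · rw [if_pos (ZMod.natCast_eq_zero_iff_even.2 he), he.neg_one_pow]
    rfl
  · rw [if_neg (fun h0 => Nat.not_even_iff_odd.2 ho (ZMod.natCast_eq_zero_iff_even.1 h0)),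
      ho.neg_one_pow]
    rfl

theorem theorem1 :
    (∀ n : ℕ, (poBar (3 * n) : ℤ) ≡
      signF n * (numReps n (fun x y => x ^ 2 + 6 * y ^ 2) : ℤ) [ZMOD 3]) ∧
    (∀ n : ℕ, (ped (3 * n + 1) : ℤ) ≡
      (-1) ^ (n + 1) * (numReps (8 * n + 3) (fun x y => 2 * x ^ 2 + 3 * y ^ 2) : ℤ) [ZMOD 3]) ∧
    (∀ n : ℕ, 1 ≤ n → (poBar (3 * n) : ℤ) ≡
      signF n * (1 + (-1) ^ (n.factorization 2 + n.factorization 3 + tCount n)) *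
        (∏ p ∈ pPrimes n, (1 + (n.factorization p : ℤ))) *
        (∏ q ∈ qPrimes n, ((1 + (-1) ^ (n.factorization q)) / 2 : ℤ)) [ZMOD 3]) ∧
    (∀ n : ℕ, (-1) ^ n * (ped (3 * n + 1) : ℤ) ≡ (poBar (48 * n + 18) : ℤ) [ZMOD 3]) := by
  refine ⟨poBar_three_mul, ped_three_mul_add_one, fun n hn => ?_,
    ped_three_mul_add_one_congr_poBar⟩
  have h := poBar_three_mul n
  rw [numReps_one_six hn, ← mul_assoc, ← mul_assoc] at h
  exact h
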